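/- **Setting.** For positive integers $\ell,m,k$, the $\ell\times m\times k$ Rubik's Cube consists of $\ell m k$ cubies at the positions $(x,y,z)$ with $0\le x<\ell$, $0\le y<m$, $0\le z<k$. A *configuration* assigns one of six colors to each visible face of each cubie. It is *solved* if each of the six sides of the cube has a single color and different sides have different colors. A *slice* is the set of cubies that match in one given coordinate. A legal *move* rotates one slice around its perpendicular: by $90^\circ$ in either direction if the slice is square, and by $180^\circ$ otherwise; if a dimension has length $1$, the only slice in that dimension may not be rotated. A *solution* of a configuration is a sequence of legal moves that leads from it to a solved configuration; it is *optimal* if no solution has fewer moves. For the $c_1\times c_2\times n$ cube, a move is *short* if it rotates a slice $z=\text{const}$ and *long* otherwise, and cubie cluster $i$ ($0\le i<n$) is the union of the slices $z=i$ and $z=n-1-i$. **Theorem.** Let $c_1,c_2\ge 1$ be fixed integers. 1. There are constants $B$ and $B'$, depending only on $c_1$ and $c_2$, such that for every $n\ge 1$ with $c_1\ne n\ne c_2$ and every configuration of the $c_1\times c_2\times n$ Rubik's Cube, every optimal solution of the configuration contains, for each cubie cluster, at most $B$ short moves that rotate a slice of this cluster, and contains at most $B'$ long moves in total. 2. An optimal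 solution can be computed in time polynomial in $n$: there are a (multi-stack) Turing machine and a polynomial $p$, both depending only on $c_1$ and $c_2$, such that for every $n\ge 1$ with $c_1\ne n\ne c_2$ and every configuration of the $c_1\times c_2\times n$ Rubik's Cube, the machine, given the list of the colors of the visible faces, halts after at most $p(n)$ steps and outputs an optimal solution (the list of its moves) if the configuration has a solution, and reports that there is none otherwise. -/

import Mathlib

namespace RubikCube

/-- The six colors. -/
abbrev Color : Type := Fin 6

/-- A visible face of a cubie of the `d 0 × d 1 × d 2` Rubik's Cube: the cubie's position, together
with the outward normal of the face, which is the positive (`positive = true`) or the negative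
direction of the coordinate axis `axis`. -/
@[ext]
structure Facelet (d : Fin 3 → ℕ) where
  pos : Fin 3 → ℕ
  axis : Fin 3
  positive : Bool
  pos_lt : ∀ a, pos a < d a
  visible : pos axis = if positive then d axis - 1 else 0

/-- A configuration maps each visible face of each cubie to a color. -/
abbrev Config (d : Fin 3 → ℕ) : Type := Facelet d → Color

/-- Each of the six sides has a single color, and different sides have different colors. -/
def Solved {d : Fin 3 → ℕ} (C : Config d) : Prop :=
  ∃ side : Fin 3 × Bool → Color, Function.Injective side ∧
    ∀ f : Facelet d, C f = side (f.axis, f.positive)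

/-- Rotations of a slice around its perpendicular: by 90° in either direction, or by 180°. -/
inductive Turn
  | ccw
  | cw
  | half
  deriving DecidableEq

/-- The opposite rotation. -/
def Turn.inverse : Turn → Turn
  | ccw => cw
  | cw => ccw
  | half => half

/-- A legal move: rotate the slice of all cubies whose coordinate `axis` equals `index`.
A square slice is rotated by 90° in either direction, any other slice by 180°; the only slice
in a dimension of length 1 is not rotated. -/
structure Move (d : Fin 3 → ℕ) where
  axis : Fin 3
  index : ℕ
  turn : Turn
  index_lt : index < d axis
  length_ne_one : d axis ≠ 1
  turn_legal : turn = Turn.half ↔ d (axis + 1) ≠ d (axis + 2)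

/-- The move that undoes `m`. -/
def Move.inverse {d : Fin 3 → ℕ} (m : Move d) : Move d where
  axis := m.axis
  index := m.index
  turn := m.turn.inverse
  index_lt := m.index_lt
  length_ne_one := m.length_ne_one
  turn_legal := by
    rw [← m.turn_legal]
    cases m.turn <;> simp [Turn.inverse]

/-- Rotation of positions around the center line of the cube parallel to axis `a`. With
`u = a + 1` and `v = a + 2` (a right-handed frame together with `a`), the counterclockwise quarter
turn sends the direction `u` to `v` and `v` to `-u`. -/
def rotatePos (d : Fin 3 → ℕ) (a : Fin 3) (t : Turn) (p : Fin 3 → ℕ) : Fin 3 → ℕ := fun e =>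
  if e = a then p e
  else match t with
    | Turn.half => d e - 1 - p e
    | Turn.ccw => if e = a + 1 then d e - 1 - p (a + 2) else p (a + 1)
    | Turn.cw => if e = a + 1 then p (a + 2) else d e - 1 - p (a + 1)

/-- The axis of the rotated normal. -/
def rotateAxis (a : Fin 3) (t : Turn) (e : Fin 3) : Fin 3 :=
  if e = a ∨ t = Turn.half then e
  else if e = a + 1 then a + 2 else a + 1

/-- The sign of the rotated normal. -/
def rotateSign (a : Fin 3) (t : Turn) (e : Fin 3) (s : Bool) : Bool :=
  match t with
  | Turn.half => if e = a then s else !s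
  | Turn.ccw => if e = a + 2 then !s else s
  | Turn.cw => if e = a + 1 then !s else s

theorem fin3_cases (a : Fin 3) : a = 0 ∨ a = 1 ∨ a = 2 := by
  revert a; decide

theorem rotatePos_lt {d : Fin 3 → ℕ} (m : Move d) {p : Fin 3 → ℕ} (hp : ∀ a, p a < d a)
    (e : Fin 3) : rotatePos d m.axis m.turn p e < d e := by
  have ht := m.turn_legal
  have h0 := hp 0
  have h1 := hp 1
  have h2 := hp 2
  generalize m.axis = a at *
  generalize m.turn = t at *
  clear hp m
  rcases fin3_cases a with rfl | rfl | rfl <;> rcases fin3_cases e with rfl | rfl | rfl <;>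
    cases t <;> simp [rotatePos] at ht ⊢ <;> omega

theorem rotatePos_visible {d : Fin 3 → ℕ} (m : Move d) (f : Facelet d) :
    rotatePos d m.axis m.turn f.pos (rotateAxis m.axis m.turn f.axis) =
      if rotateSign m.axis m.turn f.axis f.positive then
        d (rotateAxis m.axis m.turn f.axis) - 1 else 0 := by
  have ht := m.turn_legal
  obtain ⟨p, e, s, hp, hv⟩ := f
  have h0 := hp 0
  have h1 := hp 1
  have h2 := hp 2
  generalize m.axis = a at *
  generalize m.turn = t at *
  change rotatePos d a t p (rotateAxis a t e) =
    if rotateSign a t e s then d (rotateAxis a t e) - 1 else 0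
  clear hp m
  rcases fin3_cases a with rfl | rfl | rfl <;> rcases fin3_cases e with rfl | rfl | rfl <;>
    cases t <;> cases s <;> simp [rotatePos, rotateAxis, rotateSign] at ht hv ⊢ <;> omega

/-- Where the move `m` takes the visible face `f`. -/
def Facelet.rotate {d : Fin 3 → ℕ} (m : Move d) (f : Facelet d) : Facelet d :=
  if f.pos m.axis = m.index then
    { pos := rotatePos d m.axis m.turn f.pos
      axis := rotateAxis m.axis m.turn f.axis
      positive := rotateSign m.axis m.turn f.axis f.positive
      pos_lt := rotatePos_lt m f.pos_lt
      visible := rotatePos_visible m f }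
  else f

/-- The configuration after the move `m`; see `applyMove_rotate`. -/
def applyMove {d : Fin 3 → ℕ} (C : Config d) (m : Move d) : Config d :=
  fun f => C (f.rotate m.inverse)

theorem rotate_rotate_inverse {d : Fin 3 → ℕ} (m : Move d) (f : Facelet d) :
    (f.rotate m).rotate m.inverse = f := by
  by_cases h : f.pos m.axis = m.index
  · have h' : rotatePos d m.axis m.turn f.pos m.axis = m.index := by simp [rotatePos, h]
    have ht := m.turn_legal
    simp only [Facelet.rotate, h, Move.inverse, if_true, h']
    obtain ⟨p, e, s, hp, hv⟩ := f
    have h0 := hp 0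
    have h1 := hp 1
    have h2 := hp 2
    rw [Facelet.ext_iff]
    dsimp only
    clear hv h h' hp
    generalize m.axis = a at *
    generalize m.turn = t at *
    refine ⟨funext fun b => ?_, ?_, ?_⟩
    · rcases fin3_cases a with rfl | rfl | rfl <;> rcases fin3_cases b with rfl | rfl | rfl <;>
        cases t <;> simp [rotatePos, Turn.inverse] at ht ⊢ <;> omega
    · rcases fin3_cases a with rfl | rfl | rfl <;> rcases fin3_cases e with rfl | rfl | rfl <;>
        cases t <;> simp [rotateAxis, Turn.inverse]
    · rcases fin3_cases a with rfl | rfl | rfl <;> rcases fin3_cases e with rfl | rfl | rfl <;>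
        cases t <;> cases s <;> simp [rotateAxis, rotateSign, Turn.inverse]
  · simp [Facelet.rotate, Move.inverse, h]

/-- A move carries the color of each visible face along. -/
theorem applyMove_rotate {d : Fin 3 → ℕ} (C : Config d) (m : Move d) (f : Facelet d) :
    applyMove C m (f.rotate m) = C f := by
  simp [applyMove, rotate_rotate_inverse]

/-- A solution of `C`: a sequence of legal moves, performed from left to right, that leads from
`C` to a solved configuration. -/
def IsSolution {d : Fin 3 → ℕ} (C : Config d) (s : List (Move d)) : Prop :=
  Solved (s.foldl applyMove C)

/-- A solution with the smallest possible number of moves. -/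
def IsOptimalSolution {d : Fin 3 → ℕ} (C : Config d) (s : List (Move d)) : Prop :=
  IsSolution C s ∧ ∀ s' : List (Move d), IsSolution C s' → s.length ≤ s'.length

/-- `r` is a correct answer to the problem of optimally solving `C`: an optimal solution,
or `none` if `C` has no solution. -/
def IsAnswer {d : Fin 3 → ℕ} (C : Config d) : Option (List (Move d)) → Prop
  | some s => IsOptimalSolution C s
  | none => ∀ s, ¬ IsSolution C s

/-- The dimensions of the `c₁ × c₂ × n` Rubik's Cube. -/
abbrev dims (c₁ c₂ n : ℕ) : Fin 3 → ℕ := ![c₁, c₂, n]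

/-- A short move rotates a slice `z = const`; a long move rotates any other slice. -/
def Move.IsShort {d : Fin 3 → ℕ} (m : Move d) : Prop := m.axis = 2

instance {d : Fin 3 → ℕ} (m : Move d) : Decidable m.IsShort :=
  inferInstanceAs (Decidable (m.axis = 2))

/-- Number of long moves in a sequence of moves. -/
def longMoves {d : Fin 3 → ℕ} (s : List (Move d)) : ℕ :=
  s.countP fun m => ¬ m.IsShort

/-- Number of short moves in a sequence of moves that rotate one of the (at most two) slices
`z = i` and `z = (d 2 - 1) - i` of cubie cluster `i`. -/
def shortMoves {d : Fin 3 → ℕ} (i : ℕ) (s : List (Move d)) : ℕ :=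
  s.countP fun m => m.IsShort ∧ (m.index = i ∨ m.index = (d 2 - 1) - i)

/-- The color of the face with the given normal of the cubie at position `p`,
or `none` if there is no such visible face. -/
def colorAt {d : Fin 3 → ℕ} (C : Config d) (p : Fin 3 → ℕ) (a : Fin 3) (s : Bool) :
    Option Color :=
  if h : (∀ b, p b < d b) ∧ p a = if s then d a - 1 else 0 then
    some (C ⟨p, a, s, h.1, h.2⟩)
  else none

/-- A configuration as a string over the alphabet `Option Color`: slice by slice in the direction
of the third coordinate, each cubie as a block of six symbols, one for each of its faces. -/
def encodeConfig {d : Fin 3 → ℕ} (C : Config d) : List (Option Color) :=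
  (List.range (d 2)).flatMap fun z =>
    (List.range (d 0)).flatMap fun x =>
      (List.range (d 1)).flatMap fun y =>
        (List.finRange 3).flatMap fun a =>
          [false, true].map fun s => colorAt C ![x, y, z] a s

/-- The output alphabet. -/
inductive OutSym
  | axis (a : Fin 3)
  | tick
  | turn (t : Turn)
  | unsolvable

/-- A move as a string: the axis, the index of the slice in unary, the rotation. -/
def encodeMove {d : Fin 3 → ℕ} (m : Move d) : List OutSym :=
  OutSym.axis m.axis :: (List.replicate m.index OutSym.tick ++ [OutSym.turn m.turn])

/-- An answer as a string: the moves one after the other, or the symbol `unsolvable`. -/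
def encodeAnswer {d : Fin 3 → ℕ} : Option (List (Move d)) → List OutSym
  | some s => s.flatMap encodeMove
  | none => [OutSym.unsolvable]

end RubikCube

/-!
A long move of the `c₁ × c₂ × n` cube is an involution that acts on all cubie clusters at once; a
short move acts on a single cluster, and a cluster has boundedly many states as `n` varies. Fix the
long moves `w` of a solution and watch one cluster in the frame moved along by the long moves: if a
state recurs in this frame, the short moves in between can be cut out, so fewer short moves than
states suffice. Hence the function that assigns to each target coloring and each state the least
number of short moves along `w` takes only finitely many values as `w` varies, and `w` may be
replaced by one of finitely many representatives that have the same function and are no longer.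
Optimal solutions thus come from finitely many pairs of a representative and a target coloring, and
the cost of such a pair is additive over the clusters: a machine can tabulate the cost for each
state, add up in unary for each pair, and print the moves of the best one.
-/

namespace RubikCube

section MoveSequences

/-- The long moves of a sequence of moves. -/
def longs {L R : Type*} (v : List (L ⊕ R)) : List L := v.filterMap Sum.getLeft?

/-- The number of short moves of a sequence of moves. -/
def cost {L R : Type*} (v : List (L ⊕ R)) : ℕ := v.countP Sum.isRight

variable {L R S ι : Type*}

@[simp] theorem longs_inl_cons (l : L) (v : List (L ⊕ R)) :
    longs (Sum.inl l :: v) = l :: longs v := rfl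

@[simp] theorem longs_inr_cons (s : R) (v : List (L ⊕ R)) : longs (Sum.inr s :: v) = longs v := rfl

@[simp] theorem longs_append (v v' : List (L ⊕ R)) : longs (v ++ v') = longs v ++ longs v' :=
  List.filterMap_append

@[simp] theorem cost_nil : cost ([] : List (L ⊕ R)) = 0 := rfl

@[simp] theorem cost_inl_cons (l : L) (v : List (L ⊕ R)) : cost (Sum.inl l :: v) = cost v := by
  simp [cost]

@[simp] theorem cost_inr_cons (s : R) (v : List (L ⊕ R)) : cost (Sum.inr s :: v) = cost v + 1 := by
  simp [cost, List.countP_cons]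

theorem length_eq_length_longs_add_cost (u : List (L ⊕ R)) :
    u.length = (longs u).length + cost u := by
  induction u with
  | nil => rfl
  | cons a u ih => rcases a with l | r <;> simp [ih] <;> omega

/-- The short moves of `v` after its first `j` and before its next long move. -/
def segment : List (L ⊕ S) → ℕ → List S
  | [], _ => []
  | Sum.inl _ :: _, 0 => []
  | Sum.inl _ :: v, j + 1 => segment v j
  | Sum.inr s :: v, 0 => s :: segment v 0
  | Sum.inr _ :: v, j + 1 => segment v (j + 1)

theorem length_segment_le (v : List (L ⊕ S)) (j : ℕ) : (segment v j).length ≤ cost v := by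
  induction v generalizing j with
  | nil => exact Nat.zero_le _
  | cons a v ih =>
    rcases a with l | s <;> cases j <;> simp only [segment, cost_inl_cons, cost_inr_cons]
    · exact Nat.zero_le _
    · exact ih _
    · exact Nat.succ_le_succ (ih 0)
    · exact (ih _).trans (Nat.le_succ _)

/-- The sequence with long moves `w` and with the short moves `h j` after the first `j` of them. -/
def interleave : List L → (ℕ → List S) → List (L ⊕ S)
  | [], h => (h 0).map Sum.inr
  | l :: w, h => (h 0).map Sum.inr ++ Sum.inl l :: interleave w fun j => h (j + 1)

theorem interleave_longs_segment (v : List (L ⊕ S)) : interleave (longs v) (segment v) = v := by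
  induction v with
  | nil => rfl
  | cons a v ih =>
    rcases a with l | s
    · simp only [longs_inl_cons, interleave, segment, List.map_nil, List.nil_append, ih]
    · rw [longs_inr_cons]
      cases hw : longs v <;> rw [hw] at ih <;>
        simpa only [interleave, segment, List.map_cons, List.cons_append, List.cons.injEq,
          true_and] using ih

/-- The short moves `h i` of each cluster `i` in the list `is`. -/
def famSegment (is : List ι) (h : ι → List S) : List (L ⊕ (ι × S)) :=
  is.flatMap fun i => (h i).map fun s => Sum.inr (i, s)

/-- The sequence with long moves `w` and the short moves `h i j` of cluster `i` after the first
`j` of them. -/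
def famInterleave (is : List ι) : List L → (ι → ℕ → List S) → List (L ⊕ (ι × S))
  | [], h => famSegment is fun i => h i 0
  | l :: w, h => (famSegment is fun i => h i 0) ++
      Sum.inl l :: famInterleave is w fun i j => h i (j + 1)

theorem famSegment_map {κ : Type*} (g : ι → κ) (is : List ι) (h : κ → List S) :
    famSegment (L := L) (is.map g) h =
      (famSegment is fun i => h (g i)).map (Sum.map id (Prod.map g id)) := by
  simp [famSegment, List.flatMap_map, List.map_flatMap, Function.comp_def]

theorem famInterleave_map {κ : Type*} (g : ι → κ) (is : List ι) (w : List L)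
    (h : κ → ℕ → List S) :
    famInterleave (is.map g) w h =
      (famInterleave is w fun i => h (g i)).map (Sum.map id (Prod.map g id)) := by
  induction w generalizing h with
  | nil => exact famSegment_map g is _
  | cons l w ih => simp [famInterleave, famSegment_map, ih]

@[simp] theorem longs_famSegment (is : List ι) (h : ι → List S) :
    longs (famSegment (L := L) is h) = [] := by
  simp [longs, famSegment, List.filterMap_eq_nil_iff]

@[simp] theorem longs_famInterleave (is : List ι) (w : List L) (h : ι → ℕ → List S) :
    longs (famInterleave is w h) = w := by
  induction w generalizing h with
  | nil => simp [famInterleave]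
  | cons l w ih => simp [famInterleave, ih]

variable [DecidableEq ι]

/-- The moves of a sequence that affect cluster `i`. -/
def proj (i : ι) : List (L ⊕ (ι × S)) → List (L ⊕ S) :=
  List.filterMap fun
    | Sum.inl l => some (Sum.inl l)
    | Sum.inr (j, s) => if j = i then some (Sum.inr s) else none

@[simp] theorem proj_nil (i : ι) : proj i ([] : List (L ⊕ (ι × S))) = [] := rfl

@[simp] theorem proj_inl_cons (i : ι) (l : L) (u : List (L ⊕ (ι × S))) :
    proj i (Sum.inl l :: u) = Sum.inl l :: proj i u := rfl

theorem proj_inr_cons (i j : ι) (s : S) (u : List (L ⊕ (ι × S))) :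
    proj i (Sum.inr (j, s) :: u) = if j = i then Sum.inr s :: proj i u else proj i u := by
  by_cases h : j = i <;> simp [proj, h]

@[simp] theorem proj_append (i : ι) (u u' : List (L ⊕ (ι × S))) :
    proj i (u ++ u') = proj i u ++ proj i u' :=
  List.filterMap_append

@[simp] theorem longs_proj (i : ι) (u : List (L ⊕ (ι × S))) : longs (proj i u) = longs u := by
  induction u with
  | nil => rfl
  | cons a u ih =>
    rcases a with l | ⟨j, s⟩
    · simp [ih]
    · rw [proj_inr_cons]
      split <;> simp [ih]

theorem sum_cost_proj [Fintype ι] (u : List (L ⊕ (ι × S))) : ∑ i, cost (proj i u) = cost u := by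
  induction u with
  | nil => simp
  | cons a u ih =>
    rcases a with l | ⟨j, s⟩
    · simp [ih]
    · have cost_proj_cons (i : ι) : cost (proj i (Sum.inr (j, s) :: u)) =
          cost (proj i u) + if j = i then 1 else 0 := by
        rw [proj_inr_cons]
        split <;> simp
      simp [cost_proj_cons, Finset.sum_add_distrib, ih]

theorem inr_mem_of_inr_mem_proj {i : ι} {s : S} {u : List (L ⊕ (ι × S))}
    (h : Sum.inr s ∈ proj i u) : Sum.inr (i, s) ∈ u := by
  obtain ⟨_ | ⟨j, s'⟩, hu, h⟩ := List.mem_filterMap.1 h <;> simp_all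

theorem proj_map_inr (i j : ι) (h : List S) :
    proj i (h.map fun s => (Sum.inr (j, s) : L ⊕ (ι × S))) =
      if j = i then h.map Sum.inr else [] := by
  induction h with
  | nil => simp
  | cons s h ih =>
    rw [List.map_cons, proj_inr_cons, ih]
    split <;> simp

theorem proj_famSegment {is : List ι} (hn : is.Nodup) (i : ι) (h : ι → List S) :
    proj i (famSegment (L := L) is h) = if i ∈ is then (h i).map Sum.inr else [] := by
  induction is with
  | nil => rfl
  | cons j is ih =>
    rw [List.nodup_cons] at hn
    rw [famSegment, List.flatMap_cons, proj_append, ← famSegment, ih hn.2, proj_map_inr]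
    by_cases hj : j = i
    · subst hj
      simp [hn.1]
    · simp [hj, Ne.symm hj]

theorem proj_famInterleave {is : List ι} (hn : is.Nodup) {i : ι} (hi : i ∈ is) (w : List L)
    (h : ι → ℕ → List S) : proj i (famInterleave is w h) = interleave w (h i) := by
  induction w generalizing h with
  | nil => simp [famInterleave, interleave, proj_famSegment hn, hi]
  | cons l w ih => simp [famInterleave, interleave, proj_famSegment hn, hi, ih]

/-- One sequence of moves for all clusters in the list `is` that affects each cluster `i` in the
same way as `v i`, where the sequences `v i` share their long moves `w`. -/
def merge (is : List ι) (w : List L) (v : ι → List (L ⊕ S)) : List (L ⊕ (ι × S)) :=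
  famInterleave is w fun i => segment (v i)

theorem proj_merge {is : List ι} (hn : is.Nodup) {i : ι} (hi : i ∈ is) {w : List L}
    {v : ι → List (L ⊕ S)} (hw : longs (v i) = w) : proj i (merge is w v) = v i := by
  rw [merge, proj_famInterleave hn hi, ← hw, interleave_longs_segment]

omit [DecidableEq ι] in
theorem length_merge [Fintype ι] {is : List ι} (hn : is.Nodup) (his : ∀ i, i ∈ is) {w : List L}
    {v : ι → List (L ⊕ S)} (hw : ∀ i, longs (v i) = w) :
    (merge is w v).length = w.length + ∑ i, cost (v i) := by
  classical
  rw [length_eq_length_longs_add_cost, merge, longs_famInterleave, ← merge, ← sum_cost_proj]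
  simp only [proj_merge hn (his _) (hw _)]

end MoveSequences

/-- The possible states of a cubie cluster: long moves act on all clusters at once, short moves on
a single cluster, where they are available only in legal states; `good t` holds for the states
that are solved with the target coloring `t`. -/
structure ClusterSystem (X L S T : Type*) where
  long : L → X → X
  short : S → X → X
  legal : X → Prop
  good : T → X → Prop
  long_involutive : ∀ l, Function.Involutive (long l)

namespace ClusterSystem
variable {X L S T : Type*} (D : ClusterSystem X L S T)

/-- The state that a sequence of moves leads to. -/
def run (v : List (L ⊕ S)) (x : X) : X := v.foldl (fun x a => Sum.elim D.long D.short a x) x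

@[simp] theorem run_inl_cons (l : L) (v : List (L ⊕ S)) (x : X) :
    D.run (Sum.inl l :: v) x = D.run v (D.long l x) := rfl

@[simp] theorem run_inr_cons (s : S) (v : List (L ⊕ S)) (x : X) :
    D.run (Sum.inr s :: v) x = D.run v (D.short s x) := rfl

theorem run_append (v v' : List (L ⊕ S)) (x : X) : D.run (v ++ v') x = D.run v' (D.run v x) :=
  List.foldl_append

/-- The states passed by `v`, seen in the frame moved along by the long moves. -/
def trace : List (L ⊕ S) → X → List X
  | [], x => [x]
  | Sum.inl l :: v, x => (trace v (D.long l x)).map (D.long l)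
  | Sum.inr s :: v, x => x :: trace v (D.short s x)

theorem length_trace (v : List (L ⊕ S)) (x : X) : (D.trace v x).length = cost v + 1 := by
  induction v generalizing x with
  | nil => rfl
  | cons a v ih => rcases a with l | s <;> simp [trace, ih]

theorem exists_nodup_trace_of_mem_trace {v : List (L ⊕ S)} {x z : X} (h : x ∈ D.trace v z)
    (hn : (D.trace v z).Nodup) :
    ∃ v', longs v' = longs v ∧ D.run v' x = D.run v z ∧ cost v' ≤ cost v ∧
      (D.trace v' x).Nodup := by
  induction v generalizing x z with
  | nil =>
    obtain rfl : x = z := by simpa [trace] using h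
    exact ⟨[], rfl, rfl, le_rfl, hn⟩
  | cons a v ih =>
    rcases a with l | s
    · simp only [trace] at h hn
      obtain ⟨y, hy, rfl⟩ := List.mem_map.1 h
      obtain ⟨v', hlongs, hrun, hcost, hnodup⟩ := ih hy (hn.of_map _)
      refine ⟨Sum.inl l :: v', by simp [hlongs], ?_, by simpa using hcost, ?_⟩
      · simp [D.long_involutive l y, hrun]
      · simp only [trace, D.long_involutive l y]
        exact hnodup.map (D.long_involutive l).injective
    · rcases List.mem_cons.1 h with rfl | h
      · exact ⟨_, rfl, rfl, le_rfl, hn⟩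
      · obtain ⟨v', hlongs, hrun, hcost, hnodup⟩ := ih h (List.nodup_cons.1 hn).2
        exact ⟨v', hlongs, hrun, by simp only [cost_inr_cons]; omega, hnodup⟩

theorem exists_nodup_trace (v : List (L ⊕ S)) (x : X) :
    ∃ v', longs v' = longs v ∧ D.run v' x = D.run v x ∧ cost v' ≤ cost v ∧
      (D.trace v' x).Nodup := by
  induction v generalizing x with
  | nil => exact ⟨[], rfl, rfl, le_rfl, by simp [trace]⟩
  | cons a v ih =>
    rcases a with l | s
    · obtain ⟨v', hlongs, hrun, hcost, hnodup⟩ := ih (D.long l x)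
      exact ⟨Sum.inl l :: v', by simp [hlongs], by simp [hrun], by simpa using hcost,
        hnodup.map (D.long_involutive l).injective⟩
    · obtain ⟨v', hlongs, hrun, hcost, hnodup⟩ := ih (D.short s x)
      by_cases hx : x ∈ D.trace v' (D.short s x)
      · obtain ⟨v'', hlongs', hrun', hcost', hnodup'⟩ :=
          D.exists_nodup_trace_of_mem_trace hx hnodup
        exact ⟨v'', by simp [hlongs', hlongs], by simp [hrun', hrun],
          by simp only [cost_inr_cons]; omega, hnodup'⟩
      · exact ⟨Sum.inr s :: v', by simp [hlongs], by simp [hrun],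
          by simp only [cost_inr_cons]; omega, List.nodup_cons.2 ⟨hx, hnodup⟩⟩

/-- The sequence `v` of legal moves leads from `x` to a state solved with target `t`. -/
def Solves (t : T) (x : X) (v : List (L ⊕ S)) : Prop :=
  (0 < cost v → D.legal x) ∧ D.good t (D.run v x)

variable {D} in
theorem Solves.exists_cost_lt_card [Fintype X] {t : T} {x : X} {v : List (L ⊕ S)}
    (h : D.Solves t x v) :
    ∃ v', longs v' = longs v ∧ D.Solves t x v' ∧ cost v' ≤ cost v ∧ cost v' < Fintype.card X := by
  obtain ⟨v', hlongs, hrun, hcost, hnodup⟩ := D.exists_nodup_trace v x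
  have hcard := hnodup.length_le_card
  rw [length_trace] at hcard
  exact ⟨v', hlongs, ⟨fun hpos => h.1 (hpos.trans_le hcost), hrun ▸ h.2⟩, hcost, hcard⟩

open Classical in
/-- A way to solve `x` with target `t` along the long moves `w` that uses as few short moves as
possible, or `none` if there is no such way. -/
noncomputable def plan (w : List L) (t : T) (x : X) : Option (List (L ⊕ S)) :=
  if h : {v | longs v = w ∧ D.Solves t x v}.Nonempty then some (Function.argminOn cost _ h)
  else none

/-- The least number of short moves that solve `x` with target `t` along the long moves `w`. -/
noncomputable def planCost (w : List L) (t : T) (x : X) : Option ℕ := (D.plan w t x).map cost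

variable {D}

theorem longs_eq_and_solves_of_plan_eq_some {w : List L} {t : T} {x : X} {v : List (L ⊕ S)}
    (h : D.plan w t x = some v) : longs v = w ∧ D.Solves t x v := by
  unfold plan at h
  split_ifs at h with hne
  cases h
  exact Function.argminOn_mem cost _ hne

theorem Solves.exists_planCost_le {t : T} {x : X} {v : List (L ⊕ S)} (h : D.Solves t x v) :
    ∃ c ≤ cost v, D.planCost (longs v) t x = some c := by
  have hne : {v' | longs v' = longs v ∧ D.Solves t x v'}.Nonempty := ⟨v, rfl, h⟩
  refine ⟨_, Function.argminOn_le cost _ ?_, by rw [planCost, plan, dif_pos hne, Option.map_some]⟩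
  exact ⟨rfl, h⟩

theorem lt_card_of_planCost_eq_some [Fintype X] {w : List L} {t : T} {x : X} {c : ℕ}
    (h : D.planCost w t x = some c) : c < Fintype.card X := by
  obtain ⟨v, hv, -⟩ := Option.map_eq_some_iff.1 h
  obtain ⟨hlongs, hsolves⟩ := longs_eq_and_solves_of_plan_eq_some hv
  obtain ⟨v', hlongs', hsolves', -, hlt⟩ := hsolves.exists_cost_lt_card
  obtain ⟨c', hle, hc'⟩ := hsolves'.exists_planCost_le
  rw [hlongs', hlongs, h, Option.some_inj] at hc'
  omega

variable (D)

theorem finite_range_planCost [Finite X] [Finite T] : (Set.range D.planCost).Finite := by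
  have := Fintype.ofFinite X
  have hfin : (insert none (some '' Set.Iio (Fintype.card X))).Finite :=
    ((Set.finite_Iio _).image _).insert _
  refine (Set.Finite.pi' fun _ => Set.Finite.pi' fun _ => hfin).subset ?_
  rintro _ ⟨w, rfl⟩ t x
  cases h : D.planCost w t x with
  | none => exact Set.mem_insert _ _
  | some c => exact Set.mem_insert_of_mem _ ⟨c, lt_card_of_planCost_eq_some h, rfl⟩

end ClusterSystem

theorem exists_finset_minimal_representatives {α β : Type*} {f : α → β} (hf : (Set.range f).Finite)
    (size : α → ℕ) : ∃ W : Finset α, ∀ a, ∃ b ∈ W, f b = f a ∧ size b ≤ size a := by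
  classical
  have exists_minimal (y : Set.range f) : ∃ b, f b = y ∧ ∀ a, f a = y → size b ≤ size a := by
    obtain ⟨b, hb, h⟩ := exists_minimalFor_of_wellFoundedLT (fun a => f a = y) size y.2
    exact ⟨b, hb, fun a ha => (le_total _ _).elim id (h ha)⟩
  choose b hb hmin using exists_minimal
  have := hf.fintype
  refine ⟨Finset.univ.image b, fun a => ⟨b ⟨f a, a, rfl⟩, ?_, hb _, hmin _ _ rfl⟩⟩
  exact Finset.mem_image_of_mem b (Finset.mem_univ _)

namespace ClusterSystem
variable {X L S T : Type*} (D : ClusterSystem X L S T) {ι : Type*} [DecidableEq ι]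

/-- The sequence `u` of legal moves solves all clusters, in the states `ξ`, with the same target. -/
def SolvesFamily (ξ : ι → X) (u : List (L ⊕ (ι × S))) : Prop :=
  ∃ t, ∀ i, D.Solves t (ξ i) (proj i u)

theorem exists_finset_longs [Finite X] [Finite T] :
    ∃ W : Finset (List L), ∀ w, ∃ w' ∈ W, D.planCost w' = D.planCost w ∧ w'.length ≤ w.length :=
  exists_finset_minimal_representatives D.finite_range_planCost List.length

/-- The solution along the long moves `w` with target `t`: all clusters follow their plans. -/
noncomputable def candidate (is : List ι) (w : List L) (t : T) (ξ : ι → X) :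
    List (L ⊕ (ι × S)) :=
  merge is w fun i => (D.plan w t (ξ i)).getD []

variable {D} {ξ : ι → X}

theorem solvesFamily_candidate [Fintype ι] {is : List ι} (hn : is.Nodup) (his : ∀ i, i ∈ is)
    {w : List L} {t : T} {c : ι → ℕ} (hc : ∀ i, D.planCost w t (ξ i) = some (c i)) :
    D.SolvesFamily ξ (D.candidate is w t ξ) ∧
      (D.candidate is w t ξ).length = w.length + ∑ i, c i := by
  choose v hv hcost using fun i => Option.map_eq_some_iff.1 (hc i)
  have hspec (i : ι) := longs_eq_and_solves_of_plan_eq_some (hv i)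
  simp only [candidate, hv, Option.getD_some]
  refine ⟨⟨t, fun i => ?_⟩, ?_⟩
  · rw [proj_merge hn (his i) (hspec i).1]
    exact (hspec i).2
  · simp only [length_merge hn his fun i => (hspec i).1, hcost]

theorem SolvesFamily.exists_planCost_le {W : Finset (List L)}
    (hW : ∀ w, ∃ w' ∈ W, D.planCost w' = D.planCost w ∧ w'.length ≤ w.length)
    {u : List (L ⊕ (ι × S))} (h : D.SolvesFamily ξ u) :
    ∃ w ∈ W, ∃ t, ∃ c : ι → ℕ, (∀ i, D.planCost w t (ξ i) = some (c i)) ∧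
      w.length ≤ (longs u).length ∧ ∀ i, c i ≤ cost (proj i u) := by
  obtain ⟨t, ht⟩ := h
  obtain ⟨w, hw, hplan, hlen⟩ := hW (longs u)
  choose c hle hc using fun i => (ht i).exists_planCost_le
  refine ⟨w, hw, t, c, fun i => ?_, hlen, hle⟩
  rw [hplan, ← hc i, longs_proj]

theorem SolvesFamily.cost_lt_and_length_longs_le [Fintype X] [Finite ι] {W : Finset (List L)}
    (hW : ∀ w, ∃ w' ∈ W, D.planCost w' = D.planCost w ∧ w'.length ≤ w.length)
    {u : List (L ⊕ (ι × S))} (h : D.SolvesFamily ξ u)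
    (hopt : ∀ u', D.SolvesFamily ξ u' → u.length ≤ u'.length) :
    (∀ i, cost (proj i u) < Fintype.card X) ∧ (longs u).length ≤ W.sup List.length := by
  have := Fintype.ofFinite ι
  obtain ⟨w, hw, t, c, hc, hlen, hle⟩ := h.exists_planCost_le hW
  obtain ⟨hsolves, hlength⟩ := solvesFamily_candidate (Finset.nodup_toList Finset.univ)
    (fun i => Finset.mem_toList.2 (Finset.mem_univ i)) hc
  have hshort := hopt _ hsolves
  rw [hlength, length_eq_length_longs_add_cost u, ← sum_cost_proj] at hshort
  have hsum : ∑ i, c i ≤ ∑ i, cost (proj i u) := Finset.sum_le_sum fun i _ => hle i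
  have hcost : ∀ i, c i = cost (proj i u) := by
    simpa using (Finset.sum_eq_sum_iff_of_le (s := Finset.univ) fun i _ => hle i).1 (by omega)
  refine ⟨fun i => hcost i ▸ lt_card_of_planCost_eq_some (hc i), ?_⟩
  have : w.length ≤ W.sup List.length := Finset.le_sup hw
  omega

end ClusterSystem

section Cube

theorem rotatePos_rotatePos_inverse {d : Fin 3 → ℕ} (m : Move d) {p : Fin 3 → ℕ}
    (hp : ∀ a, p a < d a) :
    rotatePos d m.axis m.turn (rotatePos d m.axis m.turn.inverse p) = p := by
  obtain ⟨a, _, t, _, _, ht⟩ := m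
  have h0 := hp 0
  have h1 := hp 1
  have h2 := hp 2
  clear hp
  funext b
  rcases fin3_cases a with rfl | rfl | rfl <;> rcases fin3_cases b with rfl | rfl | rfl <;>
    cases t <;> simp [rotatePos, Turn.inverse] at ht ⊢ <;> omega

theorem rotateAxis_rotateAxis_inverse (a e : Fin 3) (t : Turn) :
    rotateAxis a t (rotateAxis a t.inverse e) = e := by
  cases t <;> revert a e <;> decide

theorem rotateSign_rotateSign_inverse (a e : Fin 3) (t : Turn) (s : Bool) :
    rotateSign a t (rotateAxis a t.inverse e) (rotateSign a t.inverse e s) = s := by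
  cases t <;> revert a e s <;> decide

theorem colorAt_applyMove {d : Fin 3 → ℕ} (C : Config d) (m : Move d) {p : Fin 3 → ℕ}
    (hp : ∀ a, p a < d a) (a : Fin 3) (s : Bool) :
    colorAt (applyMove C m) p a s = if p m.axis = m.index then
      colorAt C (rotatePos d m.axis m.turn.inverse p) (rotateAxis m.axis m.turn.inverse a)
        (rotateSign m.axis m.turn.inverse a s) else colorAt C p a s := by
  have hp' : ∀ b, rotatePos d m.axis m.turn.inverse p b < d b := rotatePos_lt m.inverse hp
  by_cases hv : p a = if s then d a - 1 else 0
  · have hv' := rotatePos_visible m.inverse ⟨p, a, s, hp, hv⟩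
    rw [colorAt, dif_pos ⟨hp, hv⟩, applyMove, Facelet.rotate, colorAt, dif_pos ⟨hp', hv'⟩, colorAt,
      dif_pos ⟨hp, hv⟩, apply_ite C, apply_ite some]
    rfl
  · have hidden (C : Config d) : colorAt C p a s = none := dif_neg fun h => hv h.2
    rw [hidden, hidden, colorAt, dif_neg, ite_self]
    rintro ⟨_, hv'⟩
    have := rotatePos_visible m ⟨_, _, _, hp', hv'⟩
    simp only [rotatePos_rotatePos_inverse m hp, rotateAxis_rotateAxis_inverse,
      rotateSign_rotateSign_inverse] at this
    exact hv this

/-- The colors of the visible faces of a slice `z = const`. -/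
abbrev Slice (c₁ c₂ : ℕ) : Type := Fin c₁ → Fin c₂ → Fin 3 → Bool → Option Color

variable {c₁ c₂ n : ℕ}

-- Without this shortcut, instance search for pairs of slices exceeds its size limit.
instance : Fintype (Slice c₁ c₂) := Pi.instFintype

/-- The slice `z = const` of a configuration. -/
def sliceOf (C : Config (dims c₁ c₂ n)) (z : ℕ) : Slice c₁ c₂ :=
  fun x y a s => colorAt C ![x, y, z] a s

/-- The effect of a short move on its slice. A position outside the slice, which arises only for
a quarter turn of a slice that is not square, has no color. -/
def turnSlice (t : Turn) (S : Slice c₁ c₂) : Slice c₁ c₂ := fun x y a s =>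
  let p := rotatePos (dims c₁ c₂ 1) 2 t.inverse ![x, y, 0]
  if h : p 0 < c₁ ∧ p 1 < c₂ then
    S ⟨p 0, h.1⟩ ⟨p 1, h.2⟩ (rotateAxis 2 t.inverse a) (rotateSign 2 t.inverse a s)
  else none

/-- The long moves: half turns of the slices `x = const` and `y = const`. -/
abbrev LongMove (c₁ c₂ : ℕ) : Type := {_x : Fin c₁ // c₁ ≠ 1} ⊕ {_y : Fin c₂ // c₂ ≠ 1}

/-- The axis of a long move. -/
def longAxis : LongMove c₁ c₂ → Fin 3 := Sum.elim (fun _ => 0) fun _ => 1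

/-- The index of the slice that a long move rotates. -/
def longIndex : LongMove c₁ c₂ → ℕ := Sum.elim (fun k => k.1) fun k => k.1

/-- The effect of a long move on the slice `S` whose mirror image is `S'`. -/
def flipSlice : LongMove c₁ c₂ → Slice c₁ c₂ → Slice c₁ c₂ → Slice c₁ c₂
  | Sum.inl k, S, S' => fun x y a s =>
      if x = k.1 then S' x y.rev a (if a = 0 then s else !s) else S x y a s
  | Sum.inr k, S, S' => fun x y a s =>
      if y = k.1 then S' x.rev y a (if a = 1 then s else !s) else S x y a s

theorem flipSlice_flipSlice (l : LongMove c₁ c₂) (S S' : Slice c₁ c₂) :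
    flipSlice l (flipSlice l S S') (flipSlice l S' S) = S := by
  funext x y a s
  rcases l with k | k
  · by_cases h : x = k.1 <;> by_cases ha : a = 0 <;> simp [flipSlice, h, ha]
  · by_cases h : y = k.1 <;> by_cases ha : a = 1 <;> simp [flipSlice, h, ha]

theorem vec_lt_dims {x y z : ℕ} (hx : x < c₁) (hy : y < c₂) (hz : z < n) (a : Fin 3) :
    (![x, y, z] : Fin 3 → ℕ) a < dims c₁ c₂ n a := by
  rcases fin3_cases a with rfl | rfl | rfl <;> simpa

theorem rotatePos_two (t : Turn) (x y z : ℕ) : rotatePos (dims c₁ c₂ n) 2 t ![x, y, z] =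
    ![rotatePos (dims c₁ c₂ 1) 2 t ![x, y, 0] 0, rotatePos (dims c₁ c₂ 1) 2 t ![x, y, 0] 1, z] := by
  funext e
  rcases fin3_cases e with rfl | rfl | rfl <;> cases t <;> simp [rotatePos]

theorem rotatePos_zero_half (x y z : ℕ) :
    rotatePos (dims c₁ c₂ n) 0 Turn.half ![x, y, z] = ![x, c₂ - 1 - y, n - 1 - z] := by
  funext e
  rcases fin3_cases e with rfl | rfl | rfl <;> simp [rotatePos]

theorem rotatePos_one_half (x y z : ℕ) :
    rotatePos (dims c₁ c₂ n) 1 Turn.half ![x, y, z] = ![c₁ - 1 - x, y, n - 1 - z] := by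
  funext e
  rcases fin3_cases e with rfl | rfl | rfl <;> simp [rotatePos]

theorem sliceOf_applyMove_of_short (C : Config (dims c₁ c₂ n)) {m : Move (dims c₁ c₂ n)}
    (hm : m.axis = 2) {z : ℕ} (hz : z < n) : sliceOf (applyMove C m) z =
      if z = m.index then turnSlice m.turn (sliceOf C z) else sliceOf C z := by
  funext x y a s
  have hlt := rotatePos_lt m.inverse (vec_lt_dims x.2 y.2 hz)
  have hcolor := colorAt_applyMove C m (vec_lt_dims x.2 y.2 hz) a s
  rw [show m.inverse.axis = 2 from hm, rotatePos_two] at hlt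
  rw [hm, rotatePos_two, show (![(x : ℕ), y, z] : Fin 3 → ℕ) 2 = z from rfl] at hcolor
  refine hcolor.trans ?_
  split_ifs
  · have hslice : rotatePos (dims c₁ c₂ 1) 2 m.turn.inverse ![x, y, 0] 0 < c₁ ∧
        rotatePos (dims c₁ c₂ 1) 2 m.turn.inverse ![x, y, 0] 1 < c₂ := ⟨hlt 0, hlt 1⟩
    simp only [turnSlice]
    rw [dif_pos hslice]
    rfl
  · rfl

theorem sliceOf_applyMove_of_long (C : Config (dims c₁ c₂ n)) {m : Move (dims c₁ c₂ n)}
    {l : LongMove c₁ c₂} (haxis : m.axis = longAxis l) (hindex : m.index = longIndex l)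
    (hturn : m.turn = Turn.half) {z : ℕ} (hz : z < n) :
    sliceOf (applyMove C m) z = flipSlice l (sliceOf C z) (sliceOf C (n - 1 - z)) := by
  funext x y a s
  have hcolor := colorAt_applyMove C m (vec_lt_dims x.2 y.2 hz) a s
  rw [haxis, hindex, hturn, Turn.inverse] at hcolor
  refine hcolor.trans ?_
  rcases l with k | k
  · simp only [longAxis, longIndex, Sum.elim_inl, rotatePos_zero_half]
    simp [flipSlice, rotateAxis, rotateSign, sliceOf, Fin.val_inj, Fin.val_rev, Nat.sub_sub,
      Nat.add_comm]
  · simp only [longAxis, longIndex, Sum.elim_inr, rotatePos_one_half]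
    simp [flipSlice, rotateAxis, rotateSign, sliceOf, Fin.val_inj, Fin.val_rev, Nat.sub_sub,
      Nat.add_comm]

/-- The six side colors of a solved cube. -/
abbrev Target : Type := {t : Fin 3 × Bool → Color // Function.Injective t}

/-- A slice has only colors that a cube with side colors `t` has. -/
def GoodSlice (t : Target) (S : Slice c₁ c₂) : Prop :=
  ∀ x y a s c, S x y a s = some c → c = t.1 (a, s)

theorem solved_iff_forall_goodSlice (C : Config (dims c₁ c₂ n)) :
    Solved C ↔ ∃ t : Target, ∀ z < n, GoodSlice t (sliceOf C z) := by
  constructor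
  · rintro ⟨t, ht, h⟩
    refine ⟨⟨t, ht⟩, fun z _ x y a s c hc => ?_⟩
    obtain ⟨hv, ⟨⟩⟩ := Option.dite_none_right_eq_some.1 hc
    exact h _
  · rintro ⟨⟨t, ht⟩, h⟩
    refine ⟨t, ht, fun f => ?_⟩
    have hpos : ![f.pos 0, f.pos 1, f.pos 2] = f.pos := by
      funext e
      rcases fin3_cases e with rfl | rfl | rfl <;> rfl
    refine h (f.pos 2) (f.pos_lt 2) ⟨f.pos 0, f.pos_lt 0⟩ ⟨f.pos 1, f.pos_lt 1⟩ f.axis f.positive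
      _ ?_
    simp only [sliceOf, hpos, colorAt]
    rw [dif_pos ⟨f.pos_lt, f.visible⟩]

/-- A cluster consists of the only slice of the cube, of its middle slice, or of two slices. -/
inductive Kind
  | single
  | middle
  | pair
  deriving DecidableEq

instance : Fintype Kind := ⟨{Kind.single, Kind.middle, Kind.pair}, fun k => by cases k <;> simp⟩

/-- The kind of a cluster and its two slices, which are equal unless the kind is `pair`. -/
abbrev ClusterState (c₁ c₂ : ℕ) : Type := Kind × Slice c₁ c₂ × Slice c₁ c₂

/-- A short move of a cluster: which of the two slices it rotates, and how. -/
abbrev ShortMove (c₁ c₂ : ℕ) : Type := Bool × {t : Turn // t = Turn.half ↔ c₁ ≠ c₂}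

/-- The effect of a short move on its cluster. -/
def turnCluster (s : ShortMove c₁ c₂) (x : ClusterState c₁ c₂) : ClusterState c₁ c₂ :=
  match x.1, s.1 with
  | Kind.pair, false => (x.1, turnSlice s.2.1 x.2.1, x.2.2)
  | Kind.pair, true => (x.1, x.2.1, turnSlice s.2.1 x.2.2)
  | _, _ => (x.1, turnSlice s.2.1 x.2.1, turnSlice s.2.1 x.2.2)

/-- The clusters of the `c₁ × c₂ × n` cubes. -/
def cubeSystem (c₁ c₂ : ℕ) :
    ClusterSystem (ClusterState c₁ c₂) (LongMove c₁ c₂) (ShortMove c₁ c₂) Target where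
  long l x := (x.1, flipSlice l x.2.1 x.2.2, flipSlice l x.2.2 x.2.1)
  short := turnCluster
  legal x := x.1 ≠ Kind.single
  good t x := GoodSlice t x.2.1 ∧ GoodSlice t x.2.2
  long_involutive l x := by simp [flipSlice_flipSlice]

/-- The kind of the cluster `{i, n - 1 - i}`, for `i < (n + 1) / 2`. -/
def clusterKind (n i : ℕ) : Kind :=
  if 2 * i + 1 = n then if n = 1 then Kind.single else Kind.middle else Kind.pair

/-- The clusters of a configuration. -/
def clusters (C : Config (dims c₁ c₂ n)) (i : Fin ((n + 1) / 2)) : ClusterState c₁ c₂ :=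
  (clusterKind n i, sliceOf C i, sliceOf C (n - 1 - i))

/-- The moves of the family of all clusters of the `c₁ × c₂ × n` cube. -/
abbrev ClusterMove (c₁ c₂ n : ℕ) : Type := LongMove c₁ c₂ ⊕ (Fin ((n + 1) / 2) × ShortMove c₁ c₂)

/-- The move `m` of the cube is the move `a` of its clusters. -/
def Represents (m : Move (dims c₁ c₂ n)) : ClusterMove c₁ c₂ n → Prop
  | Sum.inl l => m.axis = longAxis l ∧ m.index = longIndex l ∧ m.turn = Turn.half
  | Sum.inr (i, u, t) => m.axis = 2 ∧ m.index = (if u then n - 1 - i else i) ∧ m.turn = t.1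

theorem exists_represents (h₁ : c₁ ≠ n) (h₂ : n ≠ c₂) (m : Move (dims c₁ c₂ n)) :
    ∃ a, Represents m a := by
  obtain ⟨a, k, t, hk, hne, ht⟩ := m
  rcases fin3_cases a with rfl | rfl | rfl
  · exact ⟨Sum.inl (Sum.inl ⟨⟨k, hk⟩, hne⟩), rfl, rfl, ht.2 h₂.symm⟩
  · exact ⟨Sum.inl (Sum.inr ⟨⟨k, hk⟩, hne⟩), rfl, rfl, ht.2 h₁.symm⟩
  · have hkn : k < n := hk
    by_cases h : k < (n + 1) / 2
    · exact ⟨Sum.inr (⟨k, h⟩, false, ⟨t, ht⟩), rfl, by simp, rfl⟩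
    · have hmirror : k = n - 1 - (n - 1 - k) := by omega
      exact ⟨Sum.inr (⟨n - 1 - k, by omega⟩, true, ⟨t, ht⟩), rfl, hmirror, rfl⟩

theorem exists_represented (h₁ : c₁ ≠ n) (h₂ : n ≠ c₂) {a : ClusterMove c₁ c₂ n}
    (ha : ∀ i s, a = Sum.inr (i, s) → n ≠ 1) : ∃ m, Represents m a := by
  rcases a with (k | k) | ⟨i, u, t⟩
  · exact ⟨⟨0, k.1, Turn.half, k.1.2, k.2, by simpa using h₂.symm⟩, rfl, rfl, rfl⟩
  · exact ⟨⟨1, k.1, Turn.half, k.1.2, k.2, by simpa using h₁.symm⟩, rfl, rfl, rfl⟩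
  · refine ⟨⟨2, if u then n - 1 - i else i, t.1, ?_, ha _ _ rfl, t.2⟩, rfl, rfl, rfl⟩
    change (if u then n - 1 - (i : ℕ) else i) < n
    split <;> omega

section Represents
variable {m : Move (dims c₁ c₂ n)} (C : Config (dims c₁ c₂ n))

theorem Represents.clusters_applyMove_of_long {l : LongMove c₁ c₂} (h : Represents m (Sum.inl l))
    (i : Fin ((n + 1) / 2)) :
    clusters (applyMove C m) i = (cubeSystem c₁ c₂).long l (clusters C i) := by
  obtain ⟨haxis, hindex, hturn⟩ := h
  have hmirror : n - 1 - (n - 1 - (i : ℕ)) = i := by omega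
  simp only [clusters, cubeSystem,
    sliceOf_applyMove_of_long C haxis hindex hturn (show (i : ℕ) < n by omega),
    sliceOf_applyMove_of_long C haxis hindex hturn (show n - 1 - (i : ℕ) < n by omega), hmirror]

theorem Represents.sliceOf_applyMove_of_short {i : Fin ((n + 1) / 2)} {s : ShortMove c₁ c₂}
    (h : Represents m (Sum.inr (i, s))) {z : ℕ} (hz : z < n) :
    sliceOf (applyMove C m) z =
      if z = if s.1 then n - 1 - (i : ℕ) else i then turnSlice s.2.1 (sliceOf C z)
      else sliceOf C z := by
  obtain ⟨haxis, hindex, hturn⟩ := h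
  rw [RubikCube.sliceOf_applyMove_of_short C haxis hz, hindex, hturn]

theorem Represents.clusters_applyMove_of_short_of_ne {i j : Fin ((n + 1) / 2)}
    {s : ShortMove c₁ c₂} (h : Represents m (Sum.inr (i, s))) (hji : j ≠ i) :
    clusters (applyMove C m) j = clusters C j := by
  have hne : (j : ℕ) ≠ i := fun h => hji (Fin.ext h)
  have hupper : (j : ℕ) ≠ if s.1 then n - 1 - (i : ℕ) else i := by split <;> omega
  have hlower : n - 1 - (j : ℕ) ≠ if s.1 then n - 1 - (i : ℕ) else i := by split <;> omega
  simp only [clusters, h.sliceOf_applyMove_of_short C (show (j : ℕ) < n by omega),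
    h.sliceOf_applyMove_of_short C (show n - 1 - (j : ℕ) < n by omega), if_neg hupper,
    if_neg hlower]

theorem Represents.clusters_applyMove_of_short_self {i : Fin ((n + 1) / 2)} {s : ShortMove c₁ c₂}
    (h : Represents m (Sum.inr (i, s))) :
    clusters (applyMove C m) i = turnCluster s (clusters C i) := by
  simp only [clusters, h.sliceOf_applyMove_of_short C (show (i : ℕ) < n by omega),
    h.sliceOf_applyMove_of_short C (show n - 1 - (i : ℕ) < n by omega)]
  obtain ⟨u, t⟩ := s
  by_cases hmid : 2 * (i : ℕ) + 1 = n
  · have hmirror : n - 1 - (i : ℕ) = i := by omega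
    simp only [clusterKind, if_pos hmid, hmirror, ite_self, if_true]
    split <;> cases u <;> rfl
  · have hmirror : n - 1 - (i : ℕ) ≠ i := by omega
    simp only [clusterKind, if_neg hmid]
    cases u <;> simp [turnCluster, hmirror, hmirror.symm]

theorem Represents.clusters_applyMove {a : ClusterMove c₁ c₂ n} (h : Represents m a)
    (i : Fin ((n + 1) / 2)) :
    clusters (applyMove C m) i = (cubeSystem c₁ c₂).run (proj i [a]) (clusters C i) := by
  rcases a with l | ⟨j, s⟩
  · exact h.clusters_applyMove_of_long C i
  · rw [proj_inr_cons]
    split_ifs with hji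
    · subst hji
      exact h.clusters_applyMove_of_short_self C
    · exact h.clusters_applyMove_of_short_of_ne C (Ne.symm hji)

end Represents

theorem clusters_foldl_applyMove {s : List (Move (dims c₁ c₂ n))} {u : List (ClusterMove c₁ c₂ n)}
    (h : List.Forall₂ Represents s u) (C : Config (dims c₁ c₂ n)) (i : Fin ((n + 1) / 2)) :
    clusters (s.foldl applyMove C) i = (cubeSystem c₁ c₂).run (proj i u) (clusters C i) := by
  induction h generalizing C with
  | nil => rfl
  | @cons m a s u h _ ih =>
    rw [List.foldl_cons, ih, h.clusters_applyMove, ← ClusterSystem.run_append, ← proj_append,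
      List.singleton_append]

theorem solved_iff_forall_good_clusters (C : Config (dims c₁ c₂ n)) :
    Solved C ↔ ∃ t, ∀ i, (cubeSystem c₁ c₂).good t (clusters C i) := by
  rw [solved_iff_forall_goodSlice]
  refine exists_congr fun t => ⟨fun h i => ⟨h _ (by omega), h _ (by omega)⟩, fun h z hz => ?_⟩
  by_cases hz' : z < (n + 1) / 2
  · exact (h ⟨z, hz'⟩).1
  · rw [show z = n - 1 - (n - 1 - z) by omega]
    exact (h ⟨n - 1 - z, by omega⟩).2

theorem legal_clusters_iff (C : Config (dims c₁ c₂ n)) (i : Fin ((n + 1) / 2)) :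
    (cubeSystem c₁ c₂).legal (clusters C i) ↔ n ≠ 1 := by
  simp only [cubeSystem, clusters, clusterKind]
  by_cases hn : n = 1
  · subst hn
    simp
  · split <;> simp [hn]

theorem exists_mem_represents {s : List (Move (dims c₁ c₂ n))} {u : List (ClusterMove c₁ c₂ n)}
    (h : List.Forall₂ Represents s u) {a : ClusterMove c₁ c₂ n} (ha : a ∈ u) :
    ∃ m ∈ s, Represents m a := by
  obtain ⟨i, hi, rfl⟩ := List.getElem_of_mem ha
  exact ⟨_, List.getElem_mem (h.length_eq ▸ hi), h.get _ _⟩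

theorem isSolution_iff_solvesFamily {s : List (Move (dims c₁ c₂ n))}
    {u : List (ClusterMove c₁ c₂ n)} (h : List.Forall₂ Represents s u)
    (C : Config (dims c₁ c₂ n)) :
    IsSolution C s ↔ (cubeSystem c₁ c₂).SolvesFamily (clusters C) u := by
  have hlegal (i : Fin ((n + 1) / 2)) (hpos : 0 < cost (proj i u)) :
      (cubeSystem c₁ c₂).legal (clusters C i) := by
    obtain ⟨_ | r, hr, hright⟩ := List.countP_pos_iff.1 hpos
    · exact absurd hright Bool.false_ne_true
    · obtain ⟨m, -, haxis, -⟩ := exists_mem_represents h (inr_mem_of_inr_mem_proj hr)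
      exact (legal_clusters_iff C i).2 (by simpa [haxis] using m.length_ne_one)
  rw [IsSolution, solved_iff_forall_good_clusters]
  refine exists_congr fun t => forall_congr' fun i => ?_
  rw [clusters_foldl_applyMove h]
  exact ⟨fun h => ⟨hlegal i, h⟩, fun h => h.2⟩

theorem exists_forall₂_represents (h₁ : c₁ ≠ n) (h₂ : n ≠ c₂) (s : List (Move (dims c₁ c₂ n))) :
    ∃ u, List.Forall₂ Represents s u := by
  choose a ha using exists_represents h₁ h₂
  exact ⟨s.map a, List.forall₂_map_right_iff.2 (List.forall₂_same.2 fun m _ => ha m)⟩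

theorem ClusterSystem.SolvesFamily.exists_forall₂_represents (h₁ : c₁ ≠ n) (h₂ : n ≠ c₂)
    {C : Config (dims c₁ c₂ n)} {u : List (ClusterMove c₁ c₂ n)}
    (h : (cubeSystem c₁ c₂).SolvesFamily (clusters C) u) : ∃ s, List.Forall₂ Represents s u := by
  obtain ⟨t, ht⟩ := h
  have hmove : ∀ a ∈ u, ∃ m, Represents m a := by
    refine fun a ha => exists_represented h₁ h₂ fun i s hs => (legal_clusters_iff C i).1 ?_
    refine (ht i).1 (List.countP_pos_iff.2 ⟨Sum.inr s, ?_, rfl⟩)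
    exact List.mem_filterMap.2 ⟨_, hs ▸ ha, by simp⟩
  clear ht
  induction u with
  | nil => exact ⟨[], .nil⟩
  | cons a u ih =>
    obtain ⟨⟨m, hm⟩, hu⟩ := List.forall_mem_cons.1 hmove
    obtain ⟨s, hs⟩ := ih hu
    exact ⟨m :: s, .cons hm hs⟩

theorem longMoves_eq_length_longs {s : List (Move (dims c₁ c₂ n))}
    {u : List (ClusterMove c₁ c₂ n)} (h : List.Forall₂ Represents s u) :
    longMoves s = (longs u).length := by
  induction h with
  | nil => rfl
  | @cons m a s u h _ ih =>
    simp only [longMoves, Move.IsShort] at ih ⊢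
    rcases a with (k | k) | ⟨i, u, t⟩ <;> simp [ih, h.1, longAxis]

theorem shortMoves_eq_cost_proj {s : List (Move (dims c₁ c₂ n))}
    {u : List (ClusterMove c₁ c₂ n)} (h : List.Forall₂ Represents s u) {z : ℕ} (hz : z < n)
    {i : Fin ((n + 1) / 2)} (hi : (i : ℕ) = z ∨ (i : ℕ) = n - 1 - z) :
    shortMoves z s = cost (proj i u) := by
  induction h with
  | nil => rfl
  | @cons m a s u h _ ih =>
    simp only [shortMoves, Move.IsShort] at ih ⊢
    rw [List.countP_cons, ih]
    rcases a with (k | k) | ⟨j, b, t⟩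
    · simp [h.1, longAxis]
    · simp [h.1, longAxis]
    · obtain ⟨haxis, hindex, -⟩ := h
      have hji : (m.index = z ∨ m.index = n - 1 - z) ↔ j = i := by
        rw [hindex, Fin.ext_iff]
        cases b <;> simp <;> omega
      rw [proj_inr_cons]
      simp only [haxis, show dims c₁ c₂ n 2 = n from rfl, hji, true_and]
      by_cases hji : j = i <;> simp [hji]

/-- The symbols of a slice in the encoding of a configuration. -/
def encodeSlice (S : Slice c₁ c₂) : List (Option Color) :=
  (List.finRange c₁).flatMap fun x => (List.finRange c₂).flatMap fun y =>
    (List.finRange 3).flatMap fun a => [false, true].map fun s => S x y a s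

theorem encodeConfig_eq_flatMap_encodeSlice (C : Config (dims c₁ c₂ n)) :
    encodeConfig C = (List.range n).flatMap fun z => encodeSlice (sliceOf C z) := by
  simp only [encodeConfig, encodeSlice, sliceOf, dims, Matrix.cons_val,
    ← List.map_coe_finRange_eq_range, List.flatMap_map]

end Cube

section FlatMap
variable {α β : Type*} {f g : α → List β} {m : ℕ}

theorem length_flatMap_of_forall_length_eq (hf : ∀ a, (f a).length = m) (l : List α) :
    (l.flatMap f).length = l.length * m := by
  simp [List.length_flatMap, hf]

theorem eq_of_flatMap_eq_of_forall_length_eq (hf : ∀ a, (f a).length = m)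
    (hg : ∀ a, (g a).length = m) {l : List α} (h : l.flatMap f = l.flatMap g) :
    ∀ a ∈ l, f a = g a := by
  induction l with
  | nil => simp
  | cons a l ih =>
    rw [List.flatMap_cons, List.flatMap_cons] at h
    obtain ⟨hhead, htail⟩ := List.append_inj h ((hf a).trans (hg a).symm)
    exact List.forall_mem_cons.2 ⟨hhead, ih htail⟩

end FlatMap

section EncodeSlice
variable {c₁ c₂ : ℕ}

theorem length_encodeSlice (S : Slice c₁ c₂) : (encodeSlice S).length = c₁ * (c₂ * 6) := by
  rw [encodeSlice, length_flatMap_of_forall_length_eq (m := c₂ * 6), List.length_finRange]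
  intro x
  rw [length_flatMap_of_forall_length_eq (m := 6) fun _ => rfl, List.length_finRange]

theorem encodeSlice_injective :
    Function.Injective (encodeSlice : Slice c₁ c₂ → List (Option Color)) := by
  intro S S' h
  have hlength (S : Slice c₁ c₂) (x : Fin c₁) :
      ((List.finRange c₂).flatMap fun y => (List.finRange 3).flatMap fun a =>
        [false, true].map fun s => S x y a s).length = (List.finRange c₂).length * 6 :=
    length_flatMap_of_forall_length_eq (m := 6) (fun _ => rfl) _
  funext x y a s
  have hx := eq_of_flatMap_eq_of_forall_length_eq (hlength S) (hlength S') h x (List.mem_finRange x)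
  have hy := eq_of_flatMap_eq_of_forall_length_eq (m := 6) (fun _ => rfl) (fun _ => rfl) hx y
    (List.mem_finRange y)
  have ha := eq_of_flatMap_eq_of_forall_length_eq (m := 2) (fun _ => rfl) (fun _ => rfl) hy a
    (List.mem_finRange a)
  exact List.map_inj_left.1 ha s (by cases s <;> simp)

end EncodeSlice

section Program
variable {K : Type} {Γ : K → Type}

/-- Structured programs for a machine with the stacks `K`. The program `pop k f` removes the top
symbol of stack `k`, if there is one, and continues with the program that `f` assigns to it; the
program `loop k f` removes symbols from stack `k` and runs `f` on each of them until the stack is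
empty. -/
inductive Program (Γ : K → Type) : Type
  | skip
  | push (k : K) (a : Γ k)
  | seq (p q : Program Γ)
  | pop (k : K) (f : Option (Γ k) → Program Γ)
  | loop (k : K) (f : Γ k → Program Γ)

namespace Program

/-- Pushes the list `l`, whose first symbol ends up on top. -/
def pushList (k : K) (l : List (Γ k)) : Program Γ := l.foldr (fun a p => seq p (push k a)) skip

/-- Empties the stack `k`. -/
def drain (k : K) : Program Γ := loop k fun _ => skip

/-- Removes `j` symbols from stack `k` and continues with the program that `f` assigns to them. -/
def popMany (k : K) : ℕ → (List (Γ k) → Program Γ) → Program Γ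
  | 0, f => f []
  | j + 1, f => pop k fun o => o.elim skip fun a => popMany k j fun l => f (a :: l)

/-- Moves the symbols of stack `k` to stack `k'`, in reverse order. -/
def transfer (k k' : K) (f : Γ k → Γ k') : Program Γ := loop k fun a => push k' (f a)

section Exec
variable [DecidableEq K]

/-- The program transforms one assignment of contents to the stacks into another, in at most the
given number of steps. -/
inductive Exec : Program Γ → (∀ k, List (Γ k)) → ℕ → (∀ k, List (Γ k)) → Prop
  | skip (S : ∀ k, List (Γ k)) (T : ℕ) : Exec skip S T S
  | push (S : ∀ k, List (Γ k)) (T : ℕ) (k : K) (a : Γ k) :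
      Exec (push k a) S (T + 1) (Function.update S k (a :: S k))
  | seq {S S₁ S₂ : ∀ k, List (Γ k)} {T₁ T₂ : ℕ} {p q : Program Γ} :
      Exec p S T₁ S₁ → Exec q S₁ T₂ S₂ → Exec (seq p q) S (T₁ + T₂) S₂
  | pop {S S' : ∀ k, List (Γ k)} {T : ℕ} {k : K} {f : Option (Γ k) → Program Γ} :
      Exec (f (S k).head?) (Function.update S k (S k).tail) T S' → Exec (pop k f) S (T + 1) S'
  | loop_nil {S : ∀ k, List (Γ k)} {k : K} (f : Γ k → Program Γ) (T : ℕ) :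
      S k = [] → Exec (loop k f) S (T + 1) S
  | loop_cons {S S₁ S₂ : ∀ k, List (Γ k)} {T₁ T₂ : ℕ} {k : K} {f : Γ k → Program Γ} {a : Γ k}
      {l : List (Γ k)} : S k = a :: l → Exec (f a) (Function.update S k l) T₁ S₁ →
      Exec (loop k f) S₁ T₂ S₂ → Exec (loop k f) S (T₁ + T₂ + 1) S₂

theorem Exec.mono {p : Program Γ} {S S' : ∀ k, List (Γ k)} {T T' : ℕ} (h : Exec p S T S')
    (hT : T ≤ T') : Exec p S T' S' := by
  induction h generalizing T' with
  | skip S T => exact .skip S T'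
  | push S T k a =>
    obtain ⟨c, rfl⟩ := Nat.exists_eq_add_of_le' hT
    exact .push S (c + T) k a
  | seq h₁ _ _ ih₂ =>
    obtain ⟨c, rfl⟩ := Nat.exists_eq_add_of_le hT
    exact Nat.add_assoc _ _ _ ▸ .seq h₁ (ih₂ (Nat.le_add_right _ c))
  | pop _ ih =>
    obtain ⟨c, rfl⟩ := Nat.exists_eq_add_of_le' hT
    exact .pop (ih (Nat.le_add_left _ c))
  | loop_nil f T hS =>
    obtain ⟨c, rfl⟩ := Nat.exists_eq_add_of_le' hT
    exact .loop_nil f (c + T) hS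
  | @loop_cons S S₁ S₂ T₁ T₂ k f a l hS h₁ _ _ ih₂ =>
    obtain ⟨c, rfl⟩ := Nat.exists_eq_add_of_le hT
    rw [show T₁ + T₂ + 1 + c = T₁ + (T₂ + c) + 1 by omega]
    exact .loop_cons hS h₁ (ih₂ (Nat.le_add_right _ c))

theorem exec_pushList (S : ∀ k, List (Γ k)) (k : K) (l : List (Γ k)) :
    Exec (pushList k l) S l.length (Function.update S k (l ++ S k)) := by
  induction l with
  | nil => exact (Function.update_eq_self k S).symm ▸ Exec.skip S 0
  | cons a l ih =>
    have hseq := ih.seq (.push _ 0 k a)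
    rwa [Function.update_idem, Function.update_self] at hseq

theorem exec_transfer (S : ∀ k, List (Γ k)) {k k' : K} (hk : k ≠ k') (f : Γ k → Γ k') :
    Exec (transfer k k' f) S (2 * (S k).length + 1)
      (Function.update (Function.update S k []) k' (((S k).map f).reverse ++ S k')) := by
  generalize hl : S k = l
  induction l generalizing S with
  | nil =>
    rw [← hl, Function.update_eq_self, hl, List.map_nil, List.reverse_nil, List.nil_append,
      Function.update_eq_self]
    exact .loop_nil _ _ hl
  | cons a l ih =>
    have hpush := Exec.push (Function.update S k l) 0 k' (f a)
    have hloop := Exec.loop_cons hl hpush (ih _ (by simp [hk]))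
    rw [Function.update_comm hk, Function.update_idem, Function.update_self,
      Function.update_of_ne hk.symm, Function.update_comm hk.symm, Function.update_idem] at hloop
    rw [List.map_cons, List.reverse_cons, List.append_assoc, List.singleton_append]
    exact hloop.mono (by rw [List.length_cons]; omega)

theorem exec_drain (S : ∀ k, List (Γ k)) (k : K) :
    Exec (drain k) S ((S k).length + 1) (Function.update S k []) := by
  generalize hl : S k = l
  induction l generalizing S with
  | nil =>
    rw [← hl, Function.update_eq_self]
    exact .loop_nil _ _ hl
  | cons a l ih =>
    have hloop := ih (Function.update S k l) (by simp)
    rw [Function.update_idem] at hloop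
    exact (Exec.loop_cons hl (.skip _ 0) hloop).mono (by simp)

theorem exec_popMany {S S' : ∀ k, List (Γ k)} {k : K} {l l' : List (Γ k)} {T : ℕ}
    {f : List (Γ k) → Program Γ} (hS : S k = l ++ l')
    (h : Exec (f l) (Function.update S k l') T S') :
    Exec (popMany k l.length f) S (T + l.length) S' := by
  induction l generalizing S f with
  | nil =>
    obtain rfl : S k = l' := hS
    rwa [Function.update_eq_self] at h
  | cons a l ih =>
    refine .pop ?_
    rw [hS]
    exact ih (Function.update_self ..) (by rwa [Function.update_idem])

end Exec

/-- The points of a program at which a machine that executes it can stand, apart from its end. -/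
def Point : Program Γ → Type
  | skip => Empty
  | push _ _ => Unit
  | seq p q => Point p ⊕ Point q
  | pop _ f => Option (Σ o, Point (f o))
  | loop _ f => Option (Σ a, Point (f a))

instance finite_point [∀ k, Finite (Γ k)] (p : Program Γ) : Finite (Point p) := by
  induction p with
  | skip => exact inferInstanceAs (Finite Empty)
  | push => exact inferInstanceAs (Finite Unit)
  | seq p q ihp ihq => exact inferInstanceAs (Finite (Point p ⊕ Point q))
  | pop k f ih => exact inferInstanceAs (Finite (Option (Σ o, Point (f o))))
  | loop k f ih => exact inferInstanceAs (Finite (Option (Σ a, Point (f a))))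

section Compile
variable {Λ : Type}

/-- The label at which the execution of a program starts, if its points have the labels `label`
and its end has the label `exit`. -/
def entry : (p : Program Γ) → (exit : Λ) → (label : Point p → Λ) → Λ
  | skip, exit, _ => exit
  | push _ _, _, label => label ()
  | seq p q, exit, label =>
      entry p (entry q exit fun x => label (Sum.inr x)) fun x => label (Sum.inl x)
  | pop _ _, _, label => label none
  | loop _ _, _, label => label none

variable [DecidableEq K]

/-- The statements at the points of a program. The internal state of the machine holds the symbols
popped last from each stack. -/
def stmt : (p : Program Γ) → (exit : Λ) → (label : Point p → Λ) → Point p →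
    Turing.TM2.Stmt Γ Λ (∀ k, Option (Γ k))
  | push k a, exit, _, _ => .push k (fun _ => a) (.goto fun _ => exit)
  | seq p q, exit, label, Sum.inl x =>
      stmt p (entry q exit fun x => label (Sum.inr x)) (fun x => label (Sum.inl x)) x
  | seq _ q, exit, label, Sum.inr x => stmt q exit (fun x => label (Sum.inr x)) x
  | pop k f, exit, label, none => .pop k (fun v => Function.update v k)
      (.goto fun v => entry (f (v k)) exit fun x => label (some ⟨v k, x⟩))
  | pop _ f, exit, label, some ⟨o, x⟩ => stmt (f o) exit (fun x => label (some ⟨o, x⟩)) x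
  | loop k f, exit, label, none => .pop k (fun v => Function.update v k)
      (.goto fun v => (v k).elim exit fun a =>
        entry (f a) (label none) fun x => label (some ⟨a, x⟩))
  | loop _ f, _, label, some ⟨a, x⟩ => stmt (f a) (label none) (fun x => label (some ⟨a, x⟩)) x

/-- The machine `M` gets from `c` to `c'` in at most `T` steps. -/
def ReachesIn {σ : Type} (M : Λ → Turing.TM2.Stmt Γ Λ σ) (T : ℕ) (c c' : Turing.TM2.Cfg Γ Λ σ) :
    Prop :=
  Nonempty (StateTransition.EvalsToInTime (Turing.TM2.step M) c (some c') T)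

theorem reachesIn_refl {σ : Type} (M : Λ → Turing.TM2.Stmt Γ Λ σ) (T : ℕ)
    (c : Turing.TM2.Cfg Γ Λ σ) : ReachesIn M T c c :=
  ⟨⟨⟨0, rfl⟩, T.zero_le⟩⟩

theorem ReachesIn.head {σ : Type} {M : Λ → Turing.TM2.Stmt Γ Λ σ} {T : ℕ}
    {c c₁ c' : Turing.TM2.Cfg Γ Λ σ} (h₁ : Turing.TM2.step M c = some c₁)
    (h : ReachesIn M T c₁ c') : ReachesIn M (T + 1) c c' :=
  h.map fun h => .trans _ 1 T c c₁ _ ⟨⟨1, h₁⟩, le_rfl⟩ h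

theorem ReachesIn.trans {σ : Type} {M : Λ → Turing.TM2.Stmt Γ Λ σ} {T T' : ℕ}
    {c c₁ c' : Turing.TM2.Cfg Γ Λ σ} (h₁ : ReachesIn M T c c₁) (h : ReachesIn M T' c₁ c') :
    ReachesIn M (T + T') c c' := by
  obtain ⟨h₁⟩ := h₁
  rw [Nat.add_comm]
  exact h.map fun h => .trans _ T T' c c₁ _ h₁ h

theorem Exec.reachesIn {M : Λ → Turing.TM2.Stmt Γ Λ (∀ k, Option (Γ k))} {p : Program Γ} {exit : Λ}
    {label : Point p → Λ} (hM : ∀ x, M (label x) = stmt p exit label x) {S S' : ∀ k, List (Γ k)}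
    {T : ℕ} (h : Exec p S T S') (v : ∀ k, Option (Γ k)) :
    ∃ v', ReachesIn M T ⟨some (entry p exit label), v, S⟩ ⟨some exit, v', S'⟩ := by
  induction h generalizing exit v with
  | skip S T => exact ⟨v, reachesIn_refl M T _⟩
  | push S T k a =>
    exact ⟨v, (reachesIn_refl M T _).head
      (congrArg (fun q => some (Turing.TM2.stepAux q v S)) (hM ()))⟩
  | seq _ _ ih₁ ih₂ =>
    obtain ⟨v₁, h₁⟩ := ih₁ (fun x => hM (Sum.inl x)) v
    obtain ⟨v₂, h₂⟩ := ih₂ (fun x => hM (Sum.inr x)) v₁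
    exact ⟨v₂, h₁.trans h₂⟩
  | @pop S S' T k f _ ih =>
    obtain ⟨v', h⟩ := ih (fun x => hM (some ⟨_, x⟩)) (Function.update v k (S k).head?)
    have hentry : ∀ o, o = (S k).head? → entry (f o) exit (fun x => label (some ⟨o, x⟩)) =
        entry (f (S k).head?) exit fun x => label (some ⟨_, x⟩) := by
      rintro _ rfl
      rfl
    refine ⟨v', h.head ((congrArg (fun q => some (Turing.TM2.stepAux q v S)) (hM none)).trans ?_)⟩
    rw [← hentry _ (Function.update_self k _ v)]
    rfl
  | @loop_nil S k f T hS =>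
    have hS' : Function.update S k [] = S := hS ▸ Function.update_eq_self k S
    refine ⟨Function.update v k none, (reachesIn_refl M T _).head
      ((congrArg (fun q => some (Turing.TM2.stepAux q v S)) (hM none)).trans ?_)⟩
    simp only [stmt, Turing.TM2.stepAux, Function.update_self, hS, List.head?_nil, List.tail_nil,
      Option.elim_none, hS']
  | @loop_cons S S₁ S₂ T₁ T₂ k f a l hS _ _ ih₁ ih₂ =>
    obtain ⟨v₁, h₁⟩ := ih₁ (fun x => hM (some ⟨a, x⟩)) (Function.update v k (some a))
    obtain ⟨v₂, h₂⟩ := ih₂ hM v₁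
    refine ⟨v₂, (h₁.trans h₂).head
      ((congrArg (fun q => some (Turing.TM2.stepAux q v S)) (hM none)).trans ?_)⟩
    simp only [stmt, Turing.TM2.stepAux, Function.update_self, hS, List.head?_cons, List.tail_cons,
      Option.elim_some]

variable [Fintype K] [∀ k, Fintype (Γ k)]

/-- The machine that executes a program, with input on stack `input` and output on stack
`output`. -/
noncomputable def toFinTM2 (p : Program Γ) (input output : K) : Turing.FinTM2 :=
  have := Fintype.ofFinite (Point p)
  { K := K
    k₀ := input
    k₁ := output
    Γ := Γ
    Λ := Option (Point p)
    main := entry p none some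
    σ := ∀ k, Option (Γ k)
    initialState := fun _ => none
    m := fun
      | none => .load (fun _ _ => none) .halt
      | some x => stmt p none some x }

omit [Fintype K] [∀ k, Fintype (Γ k)] in
theorem update_nil_eq_dite (k : K) (l : List (Γ k)) :
    Function.update (fun _ => []) k l =
      fun k' => if h : k' = k then cast (congrArg (fun k => List (Γ k)) h.symm) l else [] := by
  funext k'
  by_cases h : k' = k
  · subst h
    simp
  · simp [h]

theorem Exec.outputsInTime {p : Program Γ} {input output : K} {l : List (Γ input)}
    {l' : List (Γ output)} {T : ℕ}
    (h : Exec p (Function.update (fun _ => []) input l) T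
      (Function.update (fun _ => []) output l')) :
    Nonempty (Turing.TM2OutputsInTime (p.toFinTM2 input output) l (some l') (T + 1)) := by
  obtain ⟨v, h⟩ := h.reachesIn (M := (p.toFinTM2 input output).m) (exit := none) (label := some)
    (fun _ => rfl) fun _ => none
  have hstart : Turing.initList (p.toFinTM2 input output) l =
      ⟨some (entry p none some), fun _ => none, Function.update (fun _ => []) input l⟩ :=
    congrArg _ (update_nil_eq_dite input l).symm
  have hhalt : Turing.haltList (p.toFinTM2 input output) l' =
      ⟨none, fun _ => none, Function.update (fun _ => []) output l'⟩ :=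
    congrArg _ (update_nil_eq_dite output l').symm
  change ReachesIn (p.toFinTM2 input output).m _ (Turing.initList (p.toFinTM2 input output) l)
    (Turing.haltList (p.toFinTM2 input output) l')
  rw [hstart, hhalt]
  exact h.trans ((reachesIn_refl _ 0 _).head rfl)

end Compile

end Program

end Program

section Memory

/-- The stacks of the machine that solves the cube. -/
inductive Stack
  | input
  | output
  | upper
  | lower
  | spare
  | clusters
  | swept
  | count
  | bad
  | best
  | surplus
  | winner
  | low
  | high
  | temp
  deriving DecidableEq

instance : Fintype Stack :=
  Fintype.ofList [.input, .output, .upper, .lower, .spare, .clusters, .swept, .count, .bad, .best,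
    .surplus, .winner, .low, .high, .temp] fun k => by cases k <;> decide

variable {c₁ c₂ : ℕ} {E : Type}

/-- The symbols on the stacks of the machine; the strategies `E` are those among which it chooses.
Counters are stacks with a single symbol. -/
abbrev Symbol (c₁ c₂ : ℕ) (E : Type) : Stack → Type
  | .input => Option Color
  | .output => OutSym
  | .upper | .lower | .spare => Slice c₁ c₂
  | .clusters | .swept => ClusterState c₁ c₂
  | .winner => E
  | .count | .bad | .best | .surplus | .low | .high | .temp => Unit

/-- The contents of all stacks; the top symbol of a stack is the head of its list. -/
structure Memory (c₁ c₂ : ℕ) (E : Type) where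
  input : List (Option Color) := []
  output : List OutSym := []
  upper : List (Slice c₁ c₂) := []
  lower : List (Slice c₁ c₂) := []
  spare : List (Slice c₁ c₂) := []
  clusters : List (ClusterState c₁ c₂) := []
  swept : List (ClusterState c₁ c₂) := []
  count : List Unit := []
  bad : List Unit := []
  best : List Unit := []
  surplus : List Unit := []
  winner : List E := []
  low : List Unit := []
  high : List Unit := []
  temp : List Unit := []

namespace Memory

/-- The contents of a stack. -/
def contents (m : Memory c₁ c₂ E) : ∀ k, List (Symbol c₁ c₂ E k)
  | .input => m.input
  | .output => m.output
  | .upper => m.upper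
  | .lower => m.lower
  | .spare => m.spare
  | .clusters => m.clusters
  | .swept => m.swept
  | .count => m.count
  | .bad => m.bad
  | .best => m.best
  | .surplus => m.surplus
  | .winner => m.winner
  | .low => m.low
  | .high => m.high
  | .temp => m.temp

/-- Replaces the contents of a stack. -/
def set (m : Memory c₁ c₂ E) : (k : Stack) → List (Symbol c₁ c₂ E k) → Memory c₁ c₂ E
  | .input, l => { m with input := l }
  | .output, l => { m with output := l }
  | .upper, l => { m with upper := l }
  | .lower, l => { m with lower := l }
  | .spare, l => { m with spare := l }
  | .clusters, l => { m with clusters := l }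
  | .swept, l => { m with swept := l }
  | .count, l => { m with count := l }
  | .bad, l => { m with bad := l }
  | .best, l => { m with best := l }
  | .surplus, l => { m with surplus := l }
  | .winner, l => { m with winner := l }
  | .low, l => { m with low := l }
  | .high, l => { m with high := l }
  | .temp, l => { m with temp := l }

theorem update_contents (m : Memory c₁ c₂ E) (k : Stack) (l : List (Symbol c₁ c₂ E k)) :
    Function.update m.contents k l = (m.set k l).contents := by
  funext k'
  cases k <;> cases k' <;> rfl

end Memory

/-- The program transforms the memory `m` into `m'` in at most `c * (n + 1) ^ d` steps. -/
def Runs (n d c : ℕ) (p : Program (Symbol c₁ c₂ E)) (m m' : Memory c₁ c₂ E) : Prop :=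
  p.Exec m.contents (c * (n + 1) ^ d) m'.contents

namespace Runs
variable {n d c c' C : ℕ} {p q : Program (Symbol c₁ c₂ E)} {m m₁ m' : Memory c₁ c₂ E} {k : Stack}

theorem mono (h : Runs n d c p m m') (hc : c ≤ c') : Runs n d c' p m m' :=
  Program.Exec.mono h (Nat.mul_le_mul_right _ hc)

theorem mono_degree {d' : ℕ} (h : Runs n d c p m m') (hd : d ≤ d') : Runs n d' c p m m' :=
  Program.Exec.mono h (Nat.mul_le_mul_left _ (Nat.pow_le_pow_right n.succ_pos hd))

theorem skip (m : Memory c₁ c₂ E) : Runs n d c .skip m m :=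
  Program.Exec.skip _ _

theorem push (m : Memory c₁ c₂ E) (k : Stack) (a : Symbol c₁ c₂ E k) :
    Runs n d 1 (.push k a) m (m.set k (a :: m.contents k)) := by
  rw [Runs, ← Memory.update_contents]
  exact (Program.Exec.push m.contents 0 k a).mono (by simp [Nat.one_le_pow])

theorem seq (h : Runs n d c p m m₁) (h' : Runs n d c' q m₁ m') :
    Runs n d (c + c') (.seq p q) m m' := by
  rw [Runs, Nat.add_mul]
  exact Program.Exec.seq h h'

theorem pop_cons {f : Option (Symbol c₁ c₂ E k) → Program (Symbol c₁ c₂ E)}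
    {a : Symbol c₁ c₂ E k} {l : List (Symbol c₁ c₂ E k)} (hm : m.contents k = a :: l)
    (h : Runs n d c (f (some a)) (m.set k l) m') : Runs n d (c + 1) (.pop k f) m m' := by
  have hpop : Program.Exec (.pop k f) m.contents (c * (n + 1) ^ d + 1) m'.contents := by
    refine .pop ?_
    rw [hm, List.tail_cons, Memory.update_contents]
    exact h
  exact hpop.mono (by rw [Nat.add_mul]; have := Nat.one_le_pow d (n + 1) n.succ_pos; omega)

theorem pop_nil {f : Option (Symbol c₁ c₂ E k) → Program (Symbol c₁ c₂ E)}
    (hm : m.contents k = []) (h : Runs n d c (f none) m m') : Runs n d (c + 1) (.pop k f) m m' := by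
  have hpop : Program.Exec (.pop k f) m.contents (c * (n + 1) ^ d + 1) m'.contents := by
    refine .pop ?_
    rw [hm, List.tail_nil, ← hm, Function.update_eq_self, hm]
    exact h
  exact hpop.mono (by rw [Nat.add_mul]; have := Nat.one_le_pow d (n + 1) n.succ_pos; omega)

theorem popMany {f : List (Symbol c₁ c₂ E k) → Program (Symbol c₁ c₂ E)}
    {l l' : List (Symbol c₁ c₂ E k)} (hm : m.contents k = l ++ l')
    (h : Runs n d c (f l) (m.set k l') m') :
    Runs n d (c + l.length) (.popMany k l.length f) m m' := by
  rw [Runs, ← Memory.update_contents] at h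
  refine (Program.exec_popMany hm h).mono ?_
  rw [Nat.add_mul]
  exact Nat.add_le_add_left (Nat.le_mul_of_pos_right _ (by positivity)) _

theorem pushList (m : Memory c₁ c₂ E) (k : Stack) (l : List (Symbol c₁ c₂ E k)) :
    Runs n d l.length (.pushList k l) m (m.set k (l ++ m.contents k)) := by
  rw [Runs, ← Memory.update_contents]
  exact (Program.exec_pushList m.contents k l).mono (Nat.le_mul_of_pos_right _ (by positivity))

theorem transfer (m : Memory c₁ c₂ E) {k' : Stack} (hk : k ≠ k')
    (f : Symbol c₁ c₂ E k → Symbol c₁ c₂ E k') (hC : (m.contents k).length ≤ C * (n + 1)) :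
    Runs n (d + 1) (2 * C + 1) (.transfer k k' f) m
      ((m.set k []).set k' (((m.contents k).map f).reverse ++ m.contents k')) := by
  rw [Runs, ← Memory.update_contents, ← Memory.update_contents]
  refine (Program.exec_transfer m.contents hk f).mono ?_
  have := Nat.one_le_pow d (n + 1) n.succ_pos
  rw [pow_succ]
  nlinarith [Nat.mul_le_mul_right (2 * C * (n + 1)) this, Nat.mul_le_mul this (n.succ_pos)]

theorem drain (m : Memory c₁ c₂ E) (k : Stack) (hC : (m.contents k).length ≤ C * (n + 1)) :
    Runs n (d + 1) (C + 1) (.drain k) m (m.set k []) := by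
  rw [Runs, ← Memory.update_contents]
  refine (Program.exec_drain m.contents k).mono ?_
  have := Nat.one_le_pow d (n + 1) n.succ_pos
  rw [pow_succ]
  nlinarith [Nat.mul_le_mul_right (C * (n + 1)) this, Nat.mul_le_mul this (n.succ_pos)]

theorem loop {f : Symbol c₁ c₂ E k → Program (Symbol c₁ c₂ E)} (state : ℕ → Memory c₁ c₂ E) {N : ℕ}
    (hbody : ∀ j < N, ∃ a l, (state j).contents k = a :: l ∧
      Runs n d c (f a) ((state j).set k l) (state (j + 1)))
    (hnil : (state N).contents k = []) (hN : N ≤ C * (n + 1)) :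
    Runs n (d + 1) (C * (c + 1) + 1) (.loop k f) (state 0) (state N) := by
  have hloop : Program.Exec (.loop k f) (state 0).contents (N * (c * (n + 1) ^ d + 1) + 1)
      (state N).contents := by
    clear hN
    induction N generalizing state with
    | zero => exact .loop_nil f _ hnil
    | succ N ih =>
      obtain ⟨a, l, hm, ha⟩ := hbody 0 N.succ_pos
      rw [Runs, ← Memory.update_contents] at ha
      refine (Program.Exec.loop_cons hm ha
        (ih (fun j => state (j + 1)) (fun j hj => hbody _ (by omega)) hnil)).mono ?_
      rw [Nat.succ_mul]
      omega
  refine hloop.mono ?_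
  have hpow := Nat.one_le_pow d (n + 1) n.succ_pos
  calc N * (c * (n + 1) ^ d + 1) + 1
      ≤ C * (n + 1) * ((c + 1) * (n + 1) ^ d) + (n + 1) ^ (d + 1) := by
        gcongr
        · rw [Nat.add_mul]
          omega
        · exact Nat.one_le_pow _ _ n.succ_pos
    _ = (C * (c + 1) + 1) * (n + 1) ^ (d + 1) := by ring

end Runs

end Memory

section Setup
variable {c₁ c₂ : ℕ} {E : Type}

/-- The list `f (j - 1), …, f 0`: the contents of a stack on which `f 0, …, f (j - 1)` have been
pushed. -/
def tower {α : Type*} (f : ℕ → α) (j : ℕ) : List α := (List.range j).reverse.map f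

@[simp] theorem tower_zero {α : Type*} (f : ℕ → α) : tower f 0 = [] := rfl

theorem tower_succ {α : Type*} (f : ℕ → α) (j : ℕ) : tower f (j + 1) = f j :: tower f j := by
  simp [tower, List.range_succ]

@[simp] theorem length_tower {α : Type*} (f : ℕ → α) (j : ℕ) : (tower f j).length = j := by
  simp [tower]

@[simp] theorem reverse_tower {α : Type*} (f : ℕ → α) (j : ℕ) :
    (tower f j).reverse = (List.range j).map f := by
  simp [tower]

/-- Reads the slices of the input and counts them. -/
noncomputable def readInput : Program (Symbol c₁ c₂ E) :=
  .loop .input fun a => .seq (.push .input a) <| .popMany .input (c₁ * (c₂ * 6)) fun b =>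
    .seq (.push .upper (Function.invFun encodeSlice b)) <|
    .seq (.push .spare (Function.invFun encodeSlice b)) <|
    .seq (.push .temp ()) (.push .high ())

theorem runs_readInput (h₁ : 1 ≤ c₁) (h₂ : 1 ≤ c₂) (n : ℕ) (s : ℕ → Slice c₁ c₂) :
    Runs n 1 (c₁ * (c₂ * 6) + 7) (readInput (E := E))
      { input := (List.range n).flatMap fun z => encodeSlice (s z) }
      { upper := tower s n, spare := tower s n, temp := List.replicate n ()
        high := List.replicate n () } := by
  let state (j : ℕ) : Memory c₁ c₂ E :=
    { input := (List.range' j (n - j)).flatMap fun z => encodeSlice (s z)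
      upper := tower s j, spare := tower s j, temp := List.replicate j ()
      high := List.replicate j () }
  suffices hloop : Runs n 1 (c₁ * (c₂ * 6) + 7) readInput (state 0) (state n) by
    rw [List.range_eq_range']
    simpa [state] using hloop
  refine (Runs.loop state (C := 1) (c := 1 + (4 + c₁ * (c₂ * 6))) (fun j hj => ?_)
    (by simp [state, Memory.contents]) (by omega)).mono (by omega)
  obtain ⟨r, hr⟩ : ∃ r, n - j = r + 1 := ⟨n - j - 1, by omega⟩
  have hr' : n - (j + 1) = r := by omega
  have hpos : 0 < (encodeSlice (s j)).length := by
    rw [length_encodeSlice]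
    positivity
  obtain ⟨a, b, hb⟩ := List.exists_cons_of_length_pos hpos
  simp only [state, hr, hr', List.range'_succ, List.flatMap_cons, hb]
  refine ⟨a, _, rfl, (Runs.push _ _ _).seq ?_⟩
  rw [← length_encodeSlice (s j)]
  refine Runs.popMany (k := .input) (l := encodeSlice (s j))
    (l' := (List.range' (j + 1) r).flatMap fun z => encodeSlice (s z)) (by rw [hb]; rfl) ?_
  rw [Function.leftInverse_invFun encodeSlice_injective, tower_succ]
  exact (Runs.push _ _ _).seq <| (Runs.push _ _ _).seq <| (Runs.push _ _ _).seq <|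
    Runs.push _ _ _

/-- Pushes the cluster with the slices `a` and `b`; the tick `o` is absent if it is the last one
and `a` is the middle slice. -/
def pushCluster (o : Option Unit) (a b : Slice c₁ c₂) : Program (Symbol c₁ c₂ E) :=
  match o with
  | some _ => .push .clusters (Kind.pair, a, b)
  | none => .pop .clusters fun o => match o with
    | some x => .seq (.push .clusters x) (.push .clusters (Kind.middle, a, b))
    | none => .push .clusters (Kind.single, a, b)

/-- Forms a cluster out of the slices on top of the stacks `lower` and `upper`. -/
def takeCluster (o : Option Unit) : Program (Symbol c₁ c₂ E) :=
  .pop .lower fun a => .pop .upper fun b => a.elim .skip fun a => b.elim .skip (pushCluster o a)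

/-- Forms the clusters out of the slices, while there are ticks that count the slices left. -/
def collectClusters : Program (Symbol c₁ c₂ E) :=
  .loop .temp fun _ => .pop .temp takeCluster

/-- The cluster `{i, n - 1 - i}` of a cube with the slices `s`. -/
def clusterAt (s : ℕ → Slice c₁ c₂) (n i : ℕ) : ClusterState c₁ c₂ :=
  (clusterKind n i, s i, s (n - 1 - i))

theorem runs_pushCluster {n d j r : ℕ} (s : ℕ → Slice c₁ c₂) (hr : n - 2 * j = r + 1)
    {m : Memory c₁ c₂ E} (hm : m.clusters = tower (clusterAt s n) j) :
    Runs n d 3 (pushCluster (List.replicate r ()).head? (s j) (s (n - 1 - j))) m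
      { m with clusters := clusterAt s n j :: m.clusters } := by
  cases r with
  | zero =>
    have hmiddle : 2 * j + 1 = n := by omega
    cases j with
    | zero =>
      have hkind : clusterKind n 0 = Kind.single := by simp [clusterKind, ← hmiddle]
      rw [clusterAt, hkind]
      exact (Runs.pop_nil (k := .clusters) (c := 1) hm (Runs.push m _ _)).mono (by omega)
    | succ j =>
      have hkind : clusterKind n (j + 1) = Kind.middle := by
        rw [clusterKind, if_pos hmiddle, if_neg (by omega)]
      rw [tower_succ] at hm
      rw [clusterAt, hkind, hm]
      exact Runs.pop_cons (k := .clusters) hm ((Runs.push _ _ _).seq (Runs.push _ _ _))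
  | succ r =>
    have hkind : clusterKind n j = Kind.pair := if_neg (by omega)
    rw [clusterAt, hkind]
    exact (Runs.push m _ _).mono (by omega)

theorem runs_takeCluster {n d j r : ℕ} (s : ℕ → Slice c₁ c₂) (hr : n - 2 * j = r + 1)
    {m : Memory c₁ c₂ E} {l u : List (Slice c₁ c₂)} (hl : m.lower = s j :: l)
    (hu : m.upper = s (n - 1 - j) :: u) (hm : m.clusters = tower (clusterAt s n) j) :
    Runs n d 5 (takeCluster (List.replicate r ()).head?) m
      { m with lower := l, upper := u, clusters := clusterAt s n j :: m.clusters } :=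
  Runs.pop_cons (k := .lower) hl <| Runs.pop_cons (k := .upper) hu <|
    runs_pushCluster s hr (m := (m.set .lower l).set .upper u) hm

theorem runs_collectClusters (n : ℕ) (s : ℕ → Slice c₁ c₂) :
    Runs n 1 8 (collectClusters (E := E))
      { upper := tower s n, lower := (List.range n).map s, temp := List.replicate n ()
        high := List.replicate n () }
      { upper := tower s (n - (n + 1) / 2)
        lower := (List.range' ((n + 1) / 2) (n - (n + 1) / 2)).map s
        clusters := tower (clusterAt s n) ((n + 1) / 2), high := List.replicate n () } := by
  let state (j : ℕ) : Memory c₁ c₂ E :=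
    { upper := tower s (n - j), lower := (List.range' j (n - j)).map s
      temp := List.replicate (n - 2 * j) (), clusters := tower (clusterAt s n) j
      high := List.replicate n () }
  suffices hloop : Runs n 1 8 collectClusters (state 0) (state ((n + 1) / 2)) by
    rw [List.range_eq_range']
    simpa [state, show n - 2 * ((n + 1) / 2) = 0 by omega] using hloop
  refine Runs.loop state (C := 1) (c := 6) (fun j hj => ?_) ?_ (by omega)
  · have hleft : n - (j + 1) = n - 1 - j := by omega
    have htop : n - j = n - 1 - j + 1 := by omega
    obtain ⟨r, hr⟩ : ∃ r, n - 2 * j = r + 1 := ⟨n - 2 * j - 1, by omega⟩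
    have htick : n - 2 * (j + 1) = r - 1 := by omega
    simp only [state, hleft, htop, hr, htick, List.range'_succ, List.map_cons, tower_succ,
      List.replicate_succ]
    refine ⟨(), _, rfl, ?_⟩
    cases r with
    | zero => exact Runs.pop_nil (k := .temp) rfl (runs_takeCluster s hr rfl rfl rfl)
    | succ r => exact Runs.pop_cons (k := .temp) rfl (runs_takeCluster s hr rfl rfl rfl)
  · simp [state, Memory.contents, show n - 2 * ((n + 1) / 2) = 0 by omega]

/-- Pushes the clusters of the input, the last one on top, and counts its slices. -/
noncomputable def setup : Program (Symbol c₁ c₂ E) :=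
  .seq readInput <| .seq (.transfer .spare .lower id) <| .seq collectClusters <|
    .seq (.drain .lower) (.drain .upper)

theorem runs_setup (h₁ : 1 ≤ c₁) (h₂ : 1 ≤ c₂) (n : ℕ) (s : ℕ → Slice c₁ c₂) :
    Runs n 1 (c₁ * (c₂ * 6) + 22) (setup (E := E))
      { input := (List.range n).flatMap fun z => encodeSlice (s z) }
      { clusters := tower (clusterAt s n) ((n + 1) / 2), high := List.replicate n () } := by
  have htransfer := Runs.transfer (n := n) (d := 0) (C := 1)
    ({ upper := tower s n, spare := tower s n, temp := List.replicate n ()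
       high := List.replicate n () } : Memory c₁ c₂ E) (k := .spare) (k' := .lower) (by decide) id
    (by simp [Memory.contents])
  simp only [Memory.set, Memory.contents, List.map_id, reverse_tower, List.append_nil] at htransfer
  exact ((runs_readInput h₁ h₂ n s).seq <| htransfer.seq <| (runs_collectClusters n s).seq <|
    (Runs.drain _ .lower (C := 1)
      (by simp only [Memory.contents, List.length_map, List.length_range']; omega)).seq <|
    Runs.drain _ .upper (C := 1)
      (by simp only [Memory.contents, Memory.set, length_tower]; omega)).mono (by omega)

end Setup

section Search
variable {c₁ c₂ : ℕ} {E : Type}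

/-- Runs `f` on the clusters, beginning with cluster `0`. -/
def sweep (f : ClusterState c₁ c₂ → Program (Symbol c₁ c₂ E)) : Program (Symbol c₁ c₂ E) :=
  .seq (.transfer .clusters .swept id) <| .loop .swept fun x => .seq (f x) (.push .clusters x)

theorem runs_sweep {n d c N : ℕ} {ξ : ℕ → ClusterState c₁ c₂}
    {f : ClusterState c₁ c₂ → Program (Symbol c₁ c₂ E)} (state : ℕ → Memory c₁ c₂ E) (hN : N ≤ n)
    (hf : ∀ j < N, ∀ u v, Runs n d c (f (ξ j)) (((state j).set .clusters u).set .swept v)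
      (((state (j + 1)).set .clusters u).set .swept v)) :
    Runs n (d + 1) (c + 6) (sweep f) (((state 0).set .clusters (tower ξ N)).set .swept [])
      (((state N).set .clusters (tower ξ N)).set .swept []) := by
  let loopState (j : ℕ) : Memory c₁ c₂ E :=
    ((state j).set .clusters (tower ξ j)).set .swept ((List.range' j (N - j)).map ξ)
  have htransfer := Runs.transfer (n := n) (d := d) (C := 1)
    (((state 0).set .clusters (tower ξ N)).set .swept []) (k := .clusters) (k' := .swept)
    (by decide) id (by simp only [Memory.contents, Memory.set, length_tower]; omega)
  simp only [Memory.set, Memory.contents, List.map_id, reverse_tower, List.append_nil]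
    at htransfer
  have hloop : Runs n (d + 1) (1 * (c + 1 + 1) + 1)
      (.loop .swept fun x => .seq (f x) (.push .clusters x)) (loopState 0) (loopState N) := by
    refine Runs.loop loopState (fun j hj => ?_)
      (by simp [loopState, Memory.contents, Memory.set]) (by omega)
    obtain ⟨r, hr⟩ : ∃ r, N - j = r + 1 := ⟨N - j - 1, by omega⟩
    have hr' : N - (j + 1) = r := by omega
    simp only [loopState, hr, hr', List.range'_succ, List.map_cons, tower_succ]
    exact ⟨ξ j, _, rfl, (hf j hj _ _).seq (Runs.push _ _ _)⟩
  simp only [loopState, Nat.sub_zero, ← List.range_eq_range', tower_zero, Nat.sub_self,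
    List.range'_zero, List.map_nil] at hloop
  exact (htransfer.seq hloop).mono (by omega)

section Strategies
variable (base : E → ℕ) (cost : E → ClusterState c₁ c₂ → Option ℕ) (ξ : ℕ → ClusterState c₁ c₂)
  (N : ℕ)

/-- The total cost of the strategy `e` for the first `N` of the clusters `ξ`. -/
def totalCost (e : E) : ℕ := base e + ∑ i ∈ Finset.range N, (cost e (ξ i)).getD 0

/-- The strategy `e` is applicable to the first `N` of the clusters `ξ`. -/
def Applies (e : E) : Prop := ∀ i < N, cost e (ξ i) ≠ none

instance : DecidablePred (Applies cost ξ N) := fun _ => Nat.decidableBallLT _ _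

/-- The better one of the strategies `o` and `e`; the former may be missing. -/
def improve (o : Option E) (e : E) : Option E :=
  if Applies cost ξ N e then
    List.argAux (fun e e' => totalCost base cost ξ N e < totalCost base cost ξ N e') o e
  else o

theorem foldl_improve (es : List E) : es.foldl (improve base cost ξ N) none =
    (es.filter fun e => Applies cost ξ N e).argmin (totalCost base cost ξ N) := by
  refine Eq.trans ?_ (List.foldl_filter ..).symm
  simp only [decide_eq_true_eq]
  rfl

/-- The memory between two stages of the search, when `o` is the best strategy so far. -/
def searchMemory (n : ℕ) (o : Option E) : Memory c₁ c₂ E where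
  clusters := tower ξ N
  high := List.replicate n ()
  winner := o.toList
  best := List.replicate (o.elim 0 (totalCost base cost ξ N)) ()

variable {ξ N}

theorem totalCost_le {C n : ℕ} {e : E} (hbase : base e ≤ C) (hcost : ∀ x, (cost e x).getD 0 ≤ C)
    (hN : N ≤ n) : totalCost base cost ξ N e ≤ C * (n + 1) := by
  have hsum : ∑ i ∈ Finset.range N, (cost e (ξ i)).getD 0 ≤ N * C := by
    simpa using Finset.sum_le_card_nsmul (Finset.range N) _ C fun i _ => hcost (ξ i)
  rw [totalCost]
  nlinarith [Nat.mul_le_mul_right C hN]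

/-- Adds the cost of the strategy `e` for the cluster `x` to the stack `count`; the stack `bad`
counts the clusters to which `e` is not applicable. -/
def tallyCluster (e : E) (x : ClusterState c₁ c₂) : Program (Symbol c₁ c₂ E) :=
  (cost e x).elim (.push .bad ()) fun c => .pushList .count (List.replicate c ())

/-- Computes the total cost of the strategy `e` on the stack `count`. -/
def tally (e : E) : Program (Symbol c₁ c₂ E) :=
  .seq (.pushList .count (List.replicate (base e) ())) (sweep (tallyCluster cost e))

theorem runs_tally {C n : ℕ} (hbase : ∀ e, base e ≤ C) (hcost : ∀ e x, (cost e x).getD 0 ≤ C)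
    (hN : N ≤ n) (o : Option E) (e : E) :
    Runs n 1 (2 * C + 7) (tally base cost e) (searchMemory base cost ξ N n o)
      (((searchMemory base cost ξ N n o).set .count
        (List.replicate (totalCost base cost ξ N e) ())).set .bad
        (List.replicate (Nat.count (fun i => cost e (ξ i) = none) N) ())) := by
  let state (j : ℕ) : Memory c₁ c₂ E := ((searchMemory base cost ξ N n o).set .count
    (List.replicate (totalCost base cost ξ j e) ())).set .bad
    (List.replicate (Nat.count (fun i => cost e (ξ i) = none) j) ())
  have hbody (j : ℕ) (u v : List (ClusterState c₁ c₂)) : Runs n 0 (C + 1)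
      (tallyCluster cost e (ξ j))
      (((state j).set .clusters u).set .swept v)
      (((state (j + 1)).set .clusters u).set .swept v) := by
    have hc := hcost e (ξ j)
    rw [tallyCluster]
    cases hj : cost e (ξ j) with
    | none =>
      simp only [state, totalCost, Finset.sum_range_succ, Nat.count_succ, hj, if_true,
        Option.getD_none, Nat.add_zero]
      exact (Runs.push _ _ _).mono (by omega)
    | some c =>
      simp only [state, totalCost, Finset.sum_range_succ, Nat.count_succ, hj, Option.getD_some,
        reduceCtorEq, if_false, Nat.add_zero]
      rw [hj, Option.getD_some] at hc
      rw [← Nat.add_assoc, Nat.add_comm _ c, List.replicate_add c]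
      refine (Runs.pushList _ .count (List.replicate c ())).mono ?_
      rw [List.length_replicate]
      omega
  have hpush := Runs.pushList (n := n) (d := 1) (searchMemory base cost ξ N n o) .count
    (List.replicate (base e) ())
  have hsweep := runs_sweep state hN fun j _ => hbody j
  have hzero : totalCost base cost ξ 0 e = base e := by simp [totalCost]
  simp only [Memory.contents, searchMemory, List.append_nil, List.length_replicate] at hpush
  simp only [state, hzero, Nat.count_zero, List.replicate_zero] at hsweep
  exact ((hpush.mono (hbase e)).seq hsweep).mono (by omega)

/-- Moves the minimum of the counters `count` and `best` to `temp`; the differences that are left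
of them end up on `count` and `surplus`. -/
def compare : Program (Symbol c₁ c₂ E) :=
  .loop .best fun _ => .pop .count fun o => o.elim (.push .surplus ()) fun _ => .push .temp ()

theorem runs_compare {n C t b : ℕ} (hb : b ≤ C * (n + 1)) {m : Memory c₁ c₂ E}
    (hs : m.surplus = []) (ht : m.temp = []) :
    Runs n 1 (C * 3 + 1) compare
      { m with count := List.replicate t (), best := List.replicate b () }
      { m with count := List.replicate (t - b) (), best := []
               surplus := List.replicate (b - t) (), temp := List.replicate (min b t) () } := by
  let state (j : ℕ) : Memory c₁ c₂ E :=
    { m with count := List.replicate (t - j) (), best := List.replicate (b - j) ()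
             temp := List.replicate (min j t) (), surplus := List.replicate (j - t) () }
  suffices hloop : Runs n 1 (C * 3 + 1) compare (state 0) (state b) by
    simpa [state, ht, hs] using hloop
  refine Runs.loop state (fun j hj => ?_) (by simp [state, Memory.contents]) hb
  obtain ⟨r, hr⟩ : ∃ r, b - j = r + 1 := ⟨b - j - 1, by omega⟩
  have hr' : b - (j + 1) = r := by omega
  simp only [state, hr, hr', List.replicate_succ]
  refine ⟨(), _, rfl, ?_⟩
  by_cases hjt : j < t
  · rw [show t - j = t - (j + 1) + 1 by omega, show min (j + 1) t = min j t + 1 by omega,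
      show j + 1 - t = j - t by omega, List.replicate_succ, List.replicate_succ]
    exact Runs.pop_cons (k := .count) rfl (Runs.push _ _ _)
  · rw [show t - j = 0 by omega, show t - (j + 1) = 0 by omega,
      show min (j + 1) t = min j t by omega, show j + 1 - t = j - t + 1 by omega,
      List.replicate_succ]
    exact Runs.pop_nil (k := .count) rfl (Runs.push _ _ _)

/-- Decides between the strategy `e`, whose total cost is on the stack `count`, and the strategy
`e'`, whose total cost is on the stack `best`. -/
def duel (e e' : E) : Program (Symbol c₁ c₂ E) :=
  .seq compare <| .seq (.drain .count) <| .seq (.transfer .temp .best id) <|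
    .pop .surplus fun o => o.elim (.push .winner e') fun _ =>
      .seq (.drain .surplus) (.push .winner e)

theorem runs_duel {n C t b : ℕ} (ht : t ≤ C * (n + 1)) (hb : b ≤ C * (n + 1)) (e e' : E)
    (xs : List (ClusterState c₁ c₂)) (us : List Unit) :
    Runs n 1 (7 * C + 7) (duel e e')
      { clusters := xs, high := us, count := List.replicate t (), best := List.replicate b () }
      { clusters := xs, high := us, best := List.replicate (if t < b then t else b) ()
        winner := [if t < b then e else e'] } := by
  have hcompare := runs_compare (t := t) hb
    (m := ({ clusters := xs, high := us } : Memory c₁ c₂ E)) rfl rfl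
  have hdrain := Runs.drain (n := n) (d := 0) (C := C)
    ({ clusters := xs, high := us, count := List.replicate (t - b) ()
       surplus := List.replicate (b - t) (), temp := List.replicate (min b t) () } :
      Memory c₁ c₂ E) .count (by simp only [Memory.contents, List.length_replicate]; omega)
  have htransfer := Runs.transfer (n := n) (d := 0) (C := C)
    ({ clusters := xs, high := us, surplus := List.replicate (b - t) ()
       temp := List.replicate (min b t) () } : Memory c₁ c₂ E) (k := .temp) (k' := .best)
    (by decide) id (by simp only [Memory.contents, List.length_replicate]; omega)
  simp only [Memory.contents, Memory.set, List.map_id, List.reverse_replicate, List.append_nil]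
    at htransfer
  refine (hcompare.seq <| hdrain.seq <| htransfer.seq (c' := C + 3) ?_).mono (by omega)
  by_cases htb : t < b
  · obtain ⟨r, hr⟩ : ∃ r, b - t = r + 1 := ⟨b - t - 1, by omega⟩
    rw [if_pos htb, if_pos htb, hr, min_eq_right htb.le]
    exact Runs.pop_cons (k := .surplus) rfl ((Runs.drain _ .surplus (C := C)
      (by simp only [Memory.contents, Memory.set, List.length_replicate]; omega)).seq
        (Runs.push _ _ _))
  · rw [if_neg htb, if_neg htb, show b - t = 0 by omega, min_eq_left (not_lt.1 htb)]
    exact (Runs.pop_nil (k := .surplus) (c := 1) rfl (Runs.push _ _ _)).mono (by omega)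

/-- Makes `e` the best strategy so far if its total cost, on the stack `count`, is less than that
of the present one, on the stack `best`. -/
def challenge (e : E) : Program (Symbol c₁ c₂ E) :=
  .pop .winner fun o => o.elim (.seq (.transfer .count .best id) (.push .winner e)) (duel e)

theorem runs_challenge {C n : ℕ} (hC : ∀ e, totalCost base cost ξ N e ≤ C * (n + 1)) (o : Option E)
    (e : E) : Runs n 1 (7 * C + 8) (challenge e)
      ((searchMemory base cost ξ N n o).set .count (List.replicate (totalCost base cost ξ N e) ()))
      (searchMemory base cost ξ N n (List.argAux
        (fun e e' => totalCost base cost ξ N e < totalCost base cost ξ N e') o e)) := by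
  cases o with
  | none =>
    have htransfer := Runs.transfer (n := n) (d := 0) (C := C)
      ((searchMemory base cost ξ N n none).set .count
        (List.replicate (totalCost base cost ξ N e) ())) (k := .count) (k' := .best)
      (by decide) id (by simpa [Memory.contents, Memory.set] using hC e)
    simp only [Memory.contents, Memory.set, searchMemory, List.map_id, List.reverse_replicate,
      Option.elim_none, List.replicate_zero, List.append_nil] at htransfer
    exact (Runs.pop_nil (k := .winner) rfl (htransfer.seq (Runs.push _ _ _))).mono (by omega)
  | some e' =>
    have hduel := runs_duel (hC e) (hC e') e e' (tower ξ N) (List.replicate n ())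
    refine Runs.pop_cons (k := .winner) (c := 7 * C + 7) rfl ?_
    simp only [List.argAux]
    split_ifs at hduel ⊢ <;> exact hduel

/-- Makes `e` the best strategy so far if it is applicable and improves on the present one. -/
def consider (e : E) : Program (Symbol c₁ c₂ E) :=
  .seq (tally base cost e) <| .pop .bad fun o => o.elim (challenge e) fun _ =>
    .seq (.drain .bad) (.drain .count)

theorem runs_consider {C n : ℕ} (hbase : ∀ e, base e ≤ C) (hcost : ∀ e x, (cost e x).getD 0 ≤ C)
    (hN : N ≤ n) (o : Option E) (e : E) : Runs n 1 (9 * C + 16) (consider base cost e)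
      (searchMemory base cost ξ N n o)
      (searchMemory base cost ξ N n (improve base cost ξ N o e)) := by
  have hC (e : E) := totalCost_le base cost (ξ := ξ) (hbase e) (hcost e) hN
  refine ((runs_tally base cost hbase hcost hN o e).seq ?_).mono (c := _ + (7 * C + 9)) (by omega)
  by_cases he : Applies cost ξ N e
  · rw [improve, if_pos he, (Nat.count_iff_forall_not).2 fun i hi => he i hi]
    exact Runs.pop_nil (k := .bad) rfl (runs_challenge base cost hC o e)
  · have hpos : Nat.count (fun i => cost e (ξ i) = none) N ≠ 0 := fun h =>
      he fun i hi => Nat.count_iff_forall_not.1 h i hi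
    obtain ⟨r, hr⟩ := Nat.exists_eq_succ_of_ne_zero hpos
    have hrN : r ≤ n := by
      have := Nat.count_le (p := fun i => cost e (ξ i) = none) (n := N)
      omega
    rw [improve, if_neg he, hr]
    exact (Runs.pop_cons (k := .bad) rfl ((Runs.drain _ .bad (C := 1)
      (by simp only [Memory.contents, Memory.set, List.length_replicate]; omega)).seq
        (Runs.drain _ .count (C := C)
          (by simpa [Memory.contents, Memory.set] using hC e)))).mono (by omega)

/-- Determines the best of the strategies `es` and leaves it on the stack `winner`. -/
def search (es : List E) : Program (Symbol c₁ c₂ E) :=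
  es.foldr (fun e p => .seq (consider base cost e) p) .skip

theorem runs_search {C n : ℕ} (hbase : ∀ e, base e ≤ C) (hcost : ∀ e x, (cost e x).getD 0 ≤ C)
    (hN : N ≤ n) (es : List E) (o : Option E) :
    Runs n 1 (es.length * (9 * C + 16)) (search base cost es) (searchMemory base cost ξ N n o)
      (searchMemory base cost ξ N n (es.foldl (improve base cost ξ N) o)) := by
  induction es generalizing o with
  | nil => exact Runs.skip _
  | cons e es ih =>
    rw [List.length_cons, Nat.succ_mul, Nat.add_comm]
    exact (runs_consider base cost hbase hcost hN o e).seq (ih _)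

end Strategies

end Search

section Printing

section MoveCode
variable {c₁ c₂ n : ℕ}

/-- The string of the move that rotates the slice with the given axis and index. -/
def sliceCode (axis : Fin 3) (index : ℕ) (t : Turn) : List OutSym :=
  OutSym.axis axis :: (List.replicate index OutSym.tick ++ [OutSym.turn t])

/-- The string of the move `s` of the cluster with the slices `lo` and `hi`. -/
def shortCode (lo hi : ℕ) (s : ShortMove c₁ c₂) : List OutSym :=
  sliceCode 2 (if s.1 then hi else lo) s.2.1

/-- The string of a long move. -/
def longCode (l : LongMove c₁ c₂) : List OutSym := sliceCode (longAxis l) (longIndex l) Turn.half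

/-- The string of a move of the clusters. -/
def clusterCode (n : ℕ) : LongMove c₁ c₂ ⊕ (ℕ × ShortMove c₁ c₂) → List OutSym :=
  Sum.elim longCode fun p => shortCode p.1 (n - 1 - p.1) p.2

theorem flatMap_encodeMove_eq {s : List (Move (dims c₁ c₂ n))} {u : List (ClusterMove c₁ c₂ n)}
    (h : List.Forall₂ Represents s u) :
    s.flatMap encodeMove = (u.map (Sum.map id (Prod.map (↑) id))).flatMap (clusterCode n) := by
  induction h with
  | nil => rfl
  | @cons m a s u h _ ih =>
    rw [List.flatMap_cons, List.map_cons, List.flatMap_cons, ih]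
    congr 1
    rcases a with l | ⟨i, u, t⟩
    · rw [encodeMove, h.1, h.2.1, h.2.2]
      rfl
    · rw [encodeMove, h.1, h.2.1, h.2.2]
      rfl

end MoveCode

variable {c₁ c₂ n : ℕ} {E : Type}

/-- The memory during the output at a cluster with `lo` slices before it, when there are `hi`
slices between it and its end of the cube. -/
def printMemory (xs ys : List (ClusterState c₁ c₂)) (out : List OutSym) (lo hi : ℕ) :
    Memory c₁ c₂ E where
  output := out
  clusters := xs
  swept := ys
  low := List.replicate lo ()
  high := List.replicate hi ()

/-- The body of the loops that print a number. -/
def printTick : Program (Symbol c₁ c₂ E) := .seq (.push .output .tick) (.push .temp ())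

/-- Prints the number on the stack `high` or on the stack `low`. -/
def printIndex (u : Bool) : Program (Symbol c₁ c₂ E) :=
  if u then .seq (.loop .high fun _ => printTick) (.transfer .temp .high id)
  else .seq (.loop .low fun _ => printTick) (.transfer .temp .low id)

variable {lo hi : ℕ} (hlo : lo ≤ n) (hhi : hi ≤ n) (xs ys : List (ClusterState c₁ c₂))
  (out : List OutSym)

include hlo hhi in
theorem runs_printIndex (u : Bool) :
    Runs n 1 7 (printIndex (E := E) u) (printMemory xs ys out lo hi)
      (printMemory xs ys (List.replicate (if u then hi else lo) OutSym.tick ++ out) lo hi) := by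
  let state (lo' hi' j : ℕ) : Memory c₁ c₂ E :=
    (printMemory xs ys (List.replicate j OutSym.tick ++ out) lo' hi').set .temp
      (List.replicate j ())
  have hbody (lo' hi' j : ℕ) : Runs n 0 2 printTick
      ((state lo' hi' j)) (state lo' hi' (j + 1)) := (Runs.push _ _ _).seq (Runs.push _ _ _)
  have hpred {N j : ℕ} (hj : j < N) :
      List.replicate (N - j) () = () :: List.replicate (N - (j + 1)) () := by
    rw [← List.replicate_succ]
    congr 1
    omega
  cases u with
  | false =>
    have hloop := Runs.loop (n := n) (d := 0) (c := 2) (k := .low) (C := 1)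
      (f := fun _ => printTick) (fun j => state (lo - j) hi j)
      (fun j hj => ⟨(), _, hpred hj, hbody (lo - (j + 1)) hi j⟩)
      (by simp [state, printMemory, Memory.set, Memory.contents]) (hlo.trans (by omega))
    have htransfer := Runs.transfer (n := n) (d := 0) (C := 1) (state 0 hi lo)
      (k := .temp) (k' := .low) (by decide) id
      (by simp only [state, Memory.set, Memory.contents, List.length_replicate]; omega)
    simp only [zero_add, Nat.reduceAdd, one_mul, mul_one, tsub_zero, tsub_self, state, printMemory,
      Memory.set, Memory.contents, List.replicate_zero, List.nil_append, List.append_nil,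
      List.map_replicate, List.reverse_replicate, id_eq] at hloop htransfer
    simpa [printIndex, printMemory] using hloop.seq htransfer
  | true =>
    have hloop := Runs.loop (n := n) (d := 0) (c := 2) (k := .high) (C := 1)
      (f := fun _ => printTick) (fun j => state lo (hi - j) j)
      (fun j hj => ⟨(), _, hpred hj, hbody lo (hi - (j + 1)) j⟩)
      (by simp [state, printMemory, Memory.set, Memory.contents]) (hhi.trans (by omega))
    have htransfer := Runs.transfer (n := n) (d := 0) (C := 1) (state lo 0 hi)
      (k := .temp) (k' := .high) (by decide) id
      (by simp only [state, Memory.set, Memory.contents, List.length_replicate]; omega)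
    simp only [zero_add, Nat.reduceAdd, one_mul, mul_one, tsub_zero, tsub_self, state, printMemory,
      Memory.set, Memory.contents, List.replicate_zero, List.nil_append, List.append_nil,
      List.map_replicate, List.reverse_replicate, id_eq] at hloop htransfer
    simpa [printIndex, printMemory] using hloop.seq htransfer

/-- Prints the moves `ss` of a cluster, the last one first. -/
def printMoves (ss : List (ShortMove c₁ c₂)) : Program (Symbol c₁ c₂ E) :=
  ss.foldr (fun s p => .seq p <| .seq (.push .output (.turn s.2.1)) <|
    .seq (printIndex s.1) (.push .output (.axis 2))) .skip

include hlo hhi in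
theorem runs_printMoves (ss : List (ShortMove c₁ c₂)) :
    Runs n 1 (ss.length * 9) (printMoves (E := E) ss) (printMemory xs ys out lo hi)
      (printMemory xs ys (ss.flatMap (shortCode lo hi) ++ out) lo hi) := by
  induction ss with
  | nil => exact Runs.skip _
  | cons s ss ih =>
    have hindex := runs_printIndex (E := E) hlo hhi xs ys
      (OutSym.turn s.2.1 :: (ss.flatMap (shortCode lo hi) ++ out)) s.1
    have hcode : (s :: ss).flatMap (shortCode lo hi) ++ out =
        OutSym.axis 2 :: (List.replicate (if s.1 then hi else lo) OutSym.tick ++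
          OutSym.turn s.2.1 :: (ss.flatMap (shortCode lo hi) ++ out)) := by
      simp [shortCode, sliceCode]
    rw [List.length_cons, Nat.succ_mul, hcode]
    exact ih.seq (c' := 1 + (7 + 1)) ((Runs.push _ _ _).seq (hindex.seq (Runs.push _ _ _)))

/-- Prints the moves `h x` of the cluster `x`, which is the next one. -/
def printCluster (h : ClusterState c₁ c₂ → List (ShortMove c₁ c₂)) (x : ClusterState c₁ c₂) :
    Program (Symbol c₁ c₂ E) :=
  .pop .high fun _ => .seq (printMoves (h x)) (.push .low ())

/-- Prints the moves `h x` of all clusters `x`, those of the last cluster first. -/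
def printSegment (h : ClusterState c₁ c₂ → List (ShortMove c₁ c₂)) : Program (Symbol c₁ c₂ E) :=
  .seq (sweep (printCluster h)) (.transfer .low .high id)

section Clusters
variable {N C : ℕ} {ξ : ℕ → ClusterState c₁ c₂}

theorem runs_printCluster {h : ClusterState c₁ c₂ → List (ShortMove c₁ c₂)}
    (hC : ∀ x, (h x).length ≤ C) {j : ℕ} (hj : j < n) :
    Runs n 1 (9 * C + 2) (printCluster (E := E) h (ξ j))
      (printMemory xs ys ((famSegment (tower id j) fun i => h (ξ i)).flatMap (clusterCode n) ++ out)
        j (n - j))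
      (printMemory xs ys
        ((famSegment (tower id (j + 1)) fun i => h (ξ i)).flatMap (clusterCode n) ++ out)
        (j + 1) (n - (j + 1))) := by
  have hsub : n - j = n - 1 - j + 1 := by omega
  have hcode : (famSegment (tower id (j + 1)) fun i => h (ξ i)).flatMap (clusterCode n) ++ out =
      (h (ξ j)).flatMap (shortCode j (n - 1 - j)) ++
        ((famSegment (tower id j) fun i => h (ξ i)).flatMap (clusterCode n) ++ out) := by
    simp [tower_succ, famSegment, List.flatMap_map, clusterCode]
  have hmoves := runs_printMoves (E := E) (n := n) (lo := j) (hi := n - 1 - j) (by omega) (by omega)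
    xs ys ((famSegment (tower id j) fun i => h (ξ i)).flatMap (clusterCode n) ++ out) (h (ξ j))
  rw [hcode, hsub, show n - (j + 1) = n - 1 - j by omega]
  refine (Runs.pop_cons (k := .high) rfl (hmoves.seq (Runs.push _ .low ()))).mono ?_
  have := hC (ξ j)
  omega

theorem runs_printSegment (hN : N ≤ n) {h : ClusterState c₁ c₂ → List (ShortMove c₁ c₂)}
    (hC : ∀ x, (h x).length ≤ C) :
    Runs n 2 (9 * C + 11) (printSegment (E := E) h) (printMemory (tower ξ N) [] out 0 n)
      (printMemory (tower ξ N) []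
        ((famSegment (tower id N) fun i => h (ξ i)).flatMap (clusterCode n) ++ out) 0 n) := by
  let state (j : ℕ) : Memory c₁ c₂ E := printMemory [] []
    ((famSegment (tower id j) fun i => h (ξ i)).flatMap (clusterCode n) ++ out) j (n - j)
  have hsweep := runs_sweep (n := n) (ξ := ξ) state hN fun j hj xs ys =>
    runs_printCluster (E := E) xs ys out hC (hj.trans_le hN)
  have htransfer := Runs.transfer (n := n) (d := 1) (C := 1)
    (printMemory (E := E) (tower ξ N) []
      ((famSegment (tower id N) fun i => h (ξ i)).flatMap (clusterCode n) ++ out) N (n - N))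
    (k := .low) (k' := .high) (by decide) id
    (by simp only [printMemory, Memory.contents, List.length_replicate]; omega)
  simp only [printMemory, Memory.set, Memory.contents, List.map_id, List.reverse_replicate,
    List.replicate_append_replicate, Nat.add_sub_cancel' hN] at htransfer
  exact (hsweep.seq htransfer).mono (by omega)

/-- Prints the move sequence with long moves `w` and with the short moves `h j x` of each cluster
`x` after the first `j` of them. -/
def print : List (LongMove c₁ c₂) → (ℕ → ClusterState c₁ c₂ → List (ShortMove c₁ c₂)) →
    Program (Symbol c₁ c₂ E)
  | [], h => printSegment (h 0)
  | l :: w, h => .seq (print w fun j => h (j + 1)) <| .seq (.pushList .output (longCode l)) <|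
      printSegment (h 0)

theorem runs_print (hN : N ≤ n) (w : List (LongMove c₁ c₂))
    {h : ℕ → ClusterState c₁ c₂ → List (ShortMove c₁ c₂)} (hC : ∀ j x, (h j x).length ≤ C) :
    Runs n 2 ((w.flatMap longCode).length + (w.length + 1) * (9 * C + 11)) (print (E := E) w h)
      (printMemory (tower ξ N) [] out 0 n)
      (printMemory (tower ξ N) []
        ((famInterleave (tower id N) w fun i j => h j (ξ i)).flatMap (clusterCode n) ++ out)
        0 n) := by
  induction w generalizing h with
  | nil => exact (runs_printSegment out hN (hC 0)).mono (by simp)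
  | cons l w ih =>
    have hlong := Runs.pushList (n := n) (d := 2) (E := E) (printMemory (tower ξ N) []
      ((famInterleave (tower id N) w fun i j => h (j + 1) (ξ i)).flatMap (clusterCode n) ++ out)
      0 n) .output (longCode l)
    have hcode : (famInterleave (tower id N) (l :: w) fun i j => h j (ξ i)).flatMap
        (clusterCode n) ++ out =
        (famSegment (tower id N) fun i => h 0 (ξ i)).flatMap (clusterCode n) ++ (longCode l ++
          ((famInterleave (tower id N) w fun i j => h (j + 1) (ξ i)).flatMap (clusterCode n) ++
            out)) := by
      simp [famInterleave, clusterCode]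
    rw [hcode]
    refine ((ih fun j => hC (j + 1)).seq (hlong.seq (runs_printSegment _ hN (hC 0)))).mono ?_
    rw [List.flatMap_cons, List.length_append, List.length_cons, Nat.add_mul (w.length + 1) 1]
    omega

end Clusters

end Printing

section Report
variable {c₁ c₂ n N C J : ℕ} {E : Type} (w : E → List (LongMove c₁ c₂))
  (h : E → ℕ → ClusterState c₁ c₂ → List (ShortMove c₁ c₂)) {ξ : ℕ → ClusterState c₁ c₂}

/-- The string of the move sequence that the strategy `e` gives for the first `N` of the clusters
`ξ`; the string `unsolvable` if there is no strategy. -/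
def reportCode (n N : ℕ) (ξ : ℕ → ClusterState c₁ c₂) (o : Option E) : List OutSym :=
  o.elim [OutSym.unsolvable] fun e =>
    (famInterleave (tower id N) (w e) fun i j => h e j (ξ i)).flatMap (clusterCode n)

/-- Prints the result of the search and clears the memory. -/
def report : Program (Symbol c₁ c₂ E) :=
  .pop .winner fun o => .seq (.drain .best) <|
    .seq (o.elim (.push .output .unsolvable) fun e => print (w e) (h e)) <|
      .seq (.drain .clusters) (.drain .high)

theorem runs_report (hN : N ≤ n) (base : E → ℕ) (cost : E → ClusterState c₁ c₂ → Option ℕ)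
    (hbest : ∀ e, totalCost base cost ξ N e ≤ C * (n + 1))
    (hJ : ∀ e x j, (h e j x).length ≤ J) {K : ℕ}
    (hK : ∀ e, ((w e).flatMap longCode).length + ((w e).length + 1) * (9 * J + 11) ≤ K)
    (o : Option E) :
    Runs n 2 (C + K + 7) (report w h) (searchMemory base cost ξ N n o)
      { output := reportCode w h n N ξ o } := by
  have hdrain (out : List OutSym) : Runs n 2 4 (.seq (.drain .clusters) (.drain .high))
      (printMemory (E := E) (tower ξ N) [] out 0 n) { output := out } :=
    (Runs.drain _ .clusters (C := 1)
      (by simp only [printMemory, Memory.contents, length_tower]; omega)).seq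
    (Runs.drain _ .high (C := 1)
      (by simp only [printMemory, Memory.contents, Memory.set, List.length_replicate]; omega))
  cases o with
  | none =>
    refine (Runs.pop_nil (k := .winner) rfl ((Runs.drain _ .best (C := C) ?_).seq
      ((Runs.push _ .output OutSym.unsolvable).seq (hdrain _)))).mono (by omega)
    simp [Memory.contents, searchMemory]
  | some e =>
    have hprint := runs_print (E := E) (n := n) (ξ := ξ) [] hN (w e) fun j x => hJ e x j
    rw [List.append_nil] at hprint
    refine (Runs.pop_cons (k := .winner) rfl ((Runs.drain _ .best (C := C) ?_).seq
      ((hprint.mono (hK e)).seq (hdrain _)))).mono (by omega)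
    simpa [Memory.contents, Memory.set, searchMemory] using hbest e

end Report

section Solver
variable {c₁ c₂ n : ℕ}

/-- The sequences of long moves among which the solver chooses. -/
noncomputable def longTemplates (c₁ c₂ : ℕ) : Finset (List (LongMove c₁ c₂)) :=
  (cubeSystem c₁ c₂).exists_finset_longs.choose

theorem exists_longTemplate (w : List (LongMove c₁ c₂)) : ∃ w' ∈ longTemplates c₁ c₂,
    (cubeSystem c₁ c₂).planCost w' = (cubeSystem c₁ c₂).planCost w ∧ w'.length ≤ w.length :=
  (cubeSystem c₁ c₂).exists_finset_longs.choose_spec w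

/-- The choices that determine a candidate for an optimal solution of all clusters: its long moves
and its target coloring. -/
abbrev Strategy (c₁ c₂ : ℕ) : Type := longTemplates c₁ c₂ × Target

namespace Strategy

/-- The long moves of a strategy. -/
def template (e : Strategy c₁ c₂) : List (LongMove c₁ c₂) := e.1

/-- The number of short moves that a strategy needs for a cluster. -/
noncomputable def clusterCost (e : Strategy c₁ c₂) : ClusterState c₁ c₂ → Option ℕ :=
  (cubeSystem c₁ c₂).planCost e.template e.2

/-- The short moves of a strategy for a cluster after the first `j` long moves. -/
noncomputable def clusterMoves (e : Strategy c₁ c₂) (j : ℕ) (x : ClusterState c₁ c₂) :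
    List (ShortMove c₁ c₂) :=
  segment (((cubeSystem c₁ c₂).plan e.template e.2 x).getD []) j

/-- The total number of moves of a strategy for a configuration. -/
noncomputable def total (C : Config (dims c₁ c₂ n)) : Strategy c₁ c₂ → ℕ :=
  totalCost (fun e => e.template.length) clusterCost (clusterAt (sliceOf C) n) ((n + 1) / 2)

/-- The strategy solves all clusters of the configuration. -/
abbrev Succeeds (C : Config (dims c₁ c₂ n)) (e : Strategy c₁ c₂) : Prop :=
  Applies clusterCost (clusterAt (sliceOf C) n) ((n + 1) / 2) e

theorem total_eq {C : Config (dims c₁ c₂ n)} {e : Strategy c₁ c₂} {c : Fin ((n + 1) / 2) → ℕ}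
    (hc : ∀ i, e.clusterCost (clusters C i) = some (c i)) :
    e.total C = e.template.length + ∑ i, c i := by
  have hcost (i : Fin ((n + 1) / 2)) : (e.clusterCost (clusterAt (sliceOf C) n i)).getD 0 = c i :=
    congrArg (Option.getD · 0) (hc i)
  rw [total, totalCost, Finset.sum_range, Fintype.sum_congr _ _ hcost]

end Strategy

theorem IsSolution.exists_strategy (h₁ : c₁ ≠ n) (h₂ : n ≠ c₂) {C : Config (dims c₁ c₂ n)}
    {s : List (Move (dims c₁ c₂ n))} (h : IsSolution C s) :
    ∃ e : Strategy c₁ c₂, e.Succeeds C ∧ e.total C ≤ s.length := by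
  obtain ⟨u, hu⟩ := exists_forall₂_represents h₁ h₂ s
  obtain ⟨w, hw, t, c, hc, hlong, hshort⟩ :=
    ((isSolution_iff_solvesFamily hu C).1 h).exists_planCost_le exists_longTemplate
  let e : Strategy c₁ c₂ := (⟨w, hw⟩, t)
  refine ⟨e, fun i hi hnone => ?_, ?_⟩
  · exact Option.some_ne_none _ ((hc ⟨i, hi⟩).symm.trans hnone)
  · rw [Strategy.total_eq (e := e) hc, hu.length_eq, length_eq_length_longs_add_cost u,
      ← sum_cost_proj]
    exact Nat.add_le_add hlong (Finset.sum_le_sum fun i _ => hshort i)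

theorem Strategy.Succeeds.exists_isSolution (h₁ : c₁ ≠ n) (h₂ : n ≠ c₂)
    {C : Config (dims c₁ c₂ n)} {e : Strategy c₁ c₂} (he : e.Succeeds C) :
    ∃ s, IsSolution C s ∧ s.length = e.total C ∧ s.flatMap encodeMove =
      reportCode Strategy.template Strategy.clusterMoves n ((n + 1) / 2)
        (clusterAt (sliceOf C) n) (some e) := by
  choose c hc using fun i : Fin ((n + 1) / 2) => Option.ne_none_iff_exists'.1 (he i i.2)
  obtain ⟨hsolves, hlength⟩ := ClusterSystem.solvesFamily_candidate (ξ := clusters C)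
    (List.nodup_reverse.2 (List.nodup_finRange _))
    (fun i => List.mem_reverse.2 (List.mem_finRange i)) hc
  obtain ⟨s, hs⟩ := hsolves.exists_forall₂_represents h₁ h₂
  refine ⟨s, (isSolution_iff_solvesFamily hs C).2 hsolves, ?_, ?_⟩
  · rw [hs.length_eq, hlength, Strategy.total_eq hc]
  · have htower : (List.finRange ((n + 1) / 2)).reverse.map Fin.val = tower id ((n + 1) / 2) := by
      rw [tower, List.map_id, List.map_reverse, List.map_coe_finRange_eq_range]
    rw [flatMap_encodeMove_eq hs, reportCode, Option.elim_some, ← htower, famInterleave_map]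
    rfl

theorem exists_isAnswer (h₁ : c₁ ≠ n) (h₂ : n ≠ c₂) (C : Config (dims c₁ c₂ n))
    {es : List (Strategy c₁ c₂)} (hes : ∀ e, e ∈ es) :
    ∃ r, IsAnswer C r ∧ encodeAnswer r =
      reportCode Strategy.template Strategy.clusterMoves n ((n + 1) / 2)
        (clusterAt (sliceOf C) n) (es.foldl (improve (fun e => e.template.length)
          Strategy.clusterCost (clusterAt (sliceOf C) n) ((n + 1) / 2)) none) := by
  rw [foldl_improve]
  cases h : List.argmin (totalCost (fun e : Strategy c₁ c₂ => e.template.length)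
      Strategy.clusterCost (clusterAt (sliceOf C) n) ((n + 1) / 2))
    (es.filter fun e => Applies Strategy.clusterCost (clusterAt (sliceOf C) n) ((n + 1) / 2) e) with
  | none =>
    refine ⟨none, fun s hs => ?_, rfl⟩
    obtain ⟨e, he, -⟩ := hs.exists_strategy h₁ h₂
    have : e ∈ [] := List.argmin_eq_none.1 h ▸ List.mem_filter.2 ⟨hes e, decide_eq_true he⟩
    exact absurd this List.not_mem_nil
  | some e =>
    obtain ⟨s, hs, hlength, hcode⟩ := Strategy.Succeeds.exists_isSolution h₁ h₂
      (of_decide_eq_true (List.mem_filter.1 (List.argmin_mem h)).2)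
    refine ⟨some s, ⟨hs, fun s' hs' => ?_⟩, hcode⟩
    obtain ⟨e', he', hle⟩ := hs'.exists_strategy h₁ h₂
    rw [hlength]
    refine le_trans ?_ hle
    exact List.le_of_mem_argmin (List.mem_filter.2 ⟨hes e', decide_eq_true he'⟩) h

theorem IsOptimalSolution.shortMoves_le_and_longMoves_le (h₁ : c₁ ≠ n) (h₂ : n ≠ c₂)
    {C : Config (dims c₁ c₂ n)} {s : List (Move (dims c₁ c₂ n))} (h : IsOptimalSolution C s) :
    (∀ z < n, shortMoves z s ≤ Fintype.card (ClusterState c₁ c₂)) ∧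
      longMoves s ≤ (longTemplates c₁ c₂).sup List.length := by
  obtain ⟨u, hu⟩ := exists_forall₂_represents h₁ h₂ s
  obtain ⟨hshort, hlong⟩ := ((isSolution_iff_solvesFamily hu C).1 h.1).cost_lt_and_length_longs_le
    exists_longTemplate fun u' hu' => by
      obtain ⟨s', hs'⟩ := hu'.exists_forall₂_represents h₁ h₂
      rw [← hu.length_eq, ← hs'.length_eq]
      exact h.2 s' ((isSolution_iff_solvesFamily hs' C).2 hu')
  refine ⟨fun z hz => ?_, (longMoves_eq_length_longs hu).trans_le hlong⟩
  obtain ⟨i, hi⟩ : ∃ i : Fin ((n + 1) / 2), (i : ℕ) = z ∨ (i : ℕ) = n - 1 - z := by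
    by_cases hlow : z < (n + 1) / 2
    · exact ⟨⟨z, hlow⟩, .inl rfl⟩
    · exact ⟨⟨n - 1 - z, by omega⟩, .inr rfl⟩
  exact (shortMoves_eq_cost_proj hu hz hi).trans_le (hshort i).le

end Solver

section Machine
variable {c₁ c₂ : ℕ}

open Classical in
noncomputable instance : Fintype OutSym :=
  Fintype.ofList [.axis 0, .axis 1, .axis 2, .tick, .turn .ccw, .turn .cw, .turn .half,
    .unsolvable] fun
    | .axis a => by fin_cases a <;> simp
    | .tick => by simp
    | .turn t => by cases t <;> simp
    | .unsolvable => by simp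

noncomputable instance {E : Type} [Fintype E] : ∀ k, Fintype (Symbol c₁ c₂ E k)
  | .input => inferInstanceAs (Fintype (Option Color))
  | .output => inferInstanceAs (Fintype OutSym)
  | .upper | .lower | .spare => inferInstanceAs (Fintype (Slice c₁ c₂))
  | .clusters | .swept => inferInstanceAs (Fintype (ClusterState c₁ c₂))
  | .winner => inferInstanceAs (Fintype E)
  | .count | .bad | .best | .surplus | .low | .high | .temp => inferInstanceAs (Fintype Unit)

theorem Strategy.clusterCost_getD_lt (e : Strategy c₁ c₂) (x : ClusterState c₁ c₂) :
    (e.clusterCost x).getD 0 < Fintype.card (ClusterState c₁ c₂) := by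
  cases h : e.clusterCost x with
  | none => exact Fintype.card_pos_iff.2 ⟨x⟩
  | some c => exact ClusterSystem.lt_card_of_planCost_eq_some h

theorem Strategy.length_clusterMoves_le (e : Strategy c₁ c₂) (j : ℕ) (x : ClusterState c₁ c₂) :
    (e.clusterMoves j x).length ≤ (e.clusterCost x).getD 0 := by
  refine (length_segment_le _ j).trans_eq ?_
  rw [clusterCost, ClusterSystem.planCost]
  cases (cubeSystem c₁ c₂).plan e.template e.2 x <;> rfl

/-- Reads a configuration, finds a best strategy, and prints the solution that it gives. -/
noncomputable def solver (c₁ c₂ : ℕ) : Program (Symbol c₁ c₂ (Strategy c₁ c₂)) :=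
  .seq setup <| .seq
    (search (fun e => e.template.length) Strategy.clusterCost Finset.univ.toList)
    (report Strategy.template Strategy.clusterMoves)

theorem exists_runs_solver (h₁ : 1 ≤ c₁) (h₂ : 1 ≤ c₂) :
    ∃ c, ∀ n, c₁ ≠ n → n ≠ c₂ → ∀ C : Config (dims c₁ c₂ n), ∃ r, IsAnswer C r ∧
      Runs n 2 c (solver c₁ c₂) { input := encodeConfig C } { output := encodeAnswer r } := by
  let es : List (Strategy c₁ c₂) := Finset.univ.toList
  let size (e : Strategy c₁ c₂) : ℕ := e.template.length
  let J := Fintype.card (ClusterState c₁ c₂)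
  let printed (e : Strategy c₁ c₂) : ℕ :=
    (e.template.flatMap longCode).length + (e.template.length + 1) * (9 * J + 11)
  let B := Finset.univ.sup size + J
  refine ⟨c₁ * (c₂ * 6) + 22 + (es.length * (9 * B + 16) + (B + Finset.univ.sup printed + 7)),
    fun n hn₁ hn₂ C => ?_⟩
  have hN : (n + 1) / 2 ≤ n := by omega
  have hsize (e : Strategy c₁ c₂) : size e ≤ B :=
    Nat.le_add_right_of_le (Finset.le_sup (Finset.mem_univ e))
  have hcost (e : Strategy c₁ c₂) (x) : (e.clusterCost x).getD 0 ≤ B :=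
    Nat.le_add_left_of_le (e.clusterCost_getD_lt x).le
  obtain ⟨r, hr, hcode⟩ := exists_isAnswer hn₁ hn₂ C (es := es) fun e =>
    Finset.mem_toList.2 (Finset.mem_univ e)
  refine ⟨r, hr, ?_⟩
  rw [encodeConfig_eq_flatMap_encodeSlice, hcode]
  exact ((runs_setup h₁ h₂ n (sliceOf C)).mono_degree one_le_two).seq <|
    ((runs_search size Strategy.clusterCost hsize hcost hN _ none).mono_degree one_le_two).seq <|
      runs_report _ _ hN size Strategy.clusterCost
        (fun e => totalCost_le _ _ (hsize e) (hcost e) hN)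
        (fun e x j => (e.length_clusterMoves_le j x).trans (e.clusterCost_getD_lt x).le)
        (fun e => Finset.le_sup (f := printed) (Finset.mem_univ e)) _

/-- The machine that solves the `c₁ × c₂ × n` cubes. -/
noncomputable def cubeMachine (c₁ c₂ : ℕ) :
    Turing.TM2ComputableAux (Option Color) OutSym where
  tm := (solver c₁ c₂).toFinTM2 Stack.input Stack.output
  inputAlphabet := Equiv.refl (Option Color)
  outputAlphabet := Equiv.refl OutSym

theorem exists_polynomial_outputsInTime_cubeMachine (h₁ : 1 ≤ c₁) (h₂ : 1 ≤ c₂) :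
    ∃ time : Polynomial ℕ, ∀ n, c₁ ≠ n → n ≠ c₂ → ∀ C : Config (dims c₁ c₂ n), ∃ r,
      IsAnswer C r ∧ Nonempty (Turing.TM2OutputsInTime (cubeMachine c₁ c₂).tm
        ((encodeConfig C).map (cubeMachine c₁ c₂).inputAlphabet.symm)
        (some ((encodeAnswer r).map (cubeMachine c₁ c₂).outputAlphabet.symm)) (time.eval n)) := by
  obtain ⟨c, hc⟩ := exists_runs_solver h₁ h₂
  refine ⟨.C c * (.X + 1) ^ 2 + 1, fun n hn₁ hn₂ C => ?_⟩
  obtain ⟨r, hr, hruns⟩ := hc n hn₁ hn₂ C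
  refine ⟨r, hr, ?_⟩
  have hin : (encodeConfig C).map (cubeMachine c₁ c₂).inputAlphabet.symm = encodeConfig C :=
    List.map_id _
  have hout : (encodeAnswer r).map (cubeMachine c₁ c₂).outputAlphabet.symm = encodeAnswer r :=
    List.map_id _
  have htime : (.C c * (.X + 1) ^ 2 + 1 : Polynomial ℕ).eval n = c * (n + 1) ^ 2 + 1 := by simp
  have hempty : (fun _ => []) = ({} : Memory c₁ c₂ (Strategy c₁ c₂)).contents := by
    funext k
    cases k <;> rfl
  rw [hin, hout, htime]
  refine Program.Exec.outputsInTime (input := Stack.input) (output := Stack.output) ?_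
  rw [hempty, Memory.update_contents, Memory.update_contents]
  exact hruns

end Machine

end RubikCube

theorem mainTheorem6 (c₁ c₂ : ℕ) (hc₁ : 0 < c₁) (hc₂ : 0 < c₂) :
    -- the structure of optimal solutions
    (∃ boundShort boundLong : ℕ, ∀ n : ℕ, 0 < n → c₁ ≠ n → n ≠ c₂ →
      ∀ (C : RubikCube.Config (RubikCube.dims c₁ c₂ n))
        (s : List (RubikCube.Move (RubikCube.dims c₁ c₂ n))),
        RubikCube.IsOptimalSolution C s →
          (∀ i < n, RubikCube.shortMoves i s ≤ boundShort) ∧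
          RubikCube.longMoves s ≤ boundLong) ∧
    -- one machine answers all configurations for all `n`, in time polynomial in `n`
    (∃ (M : Turing.TM2ComputableAux (Option RubikCube.Color) RubikCube.OutSym)
        (time : Polynomial ℕ),
      ∀ n : ℕ, 0 < n → c₁ ≠ n → n ≠ c₂ →
        ∀ C : RubikCube.Config (RubikCube.dims c₁ c₂ n),
          ∃ r : Option (List (RubikCube.Move (RubikCube.dims c₁ c₂ n))),
            RubikCube.IsAnswer C r ∧
            Nonempty (Turing.TM2OutputsInTime M.tm
              ((RubikCube.encodeConfig C).map M.inputAlphabet.symm)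
              (some ((RubikCube.encodeAnswer r).map M.outputAlphabet.symm))
              (time.eval n))) := by
  constructor
  · exact ⟨_, _, fun n _ h₁ h₂ C s h =>
      RubikCube.IsOptimalSolution.shortMoves_le_and_longMoves_le h₁ h₂ h⟩
  · obtain ⟨time, htime⟩ := RubikCube.exists_polynomial_outputsInTime_cubeMachine hc₁ hc₂
    exact ⟨RubikCube.cubeMachine c₁ c₂, time, fun n _ h₁ h₂ => htime n h₁ h₂⟩
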